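/- **Model.** Let $V=\{1,\dots,d\}$. For every unordered pair $\{i,j\}$ of vertices ($i=j$ allowed) let $\phi_{ij}=\phi_{ji}=(\phi_{ij}^u)_{u\le m_{ij}}$ be twice continuously differentiable functions on $\mathbb{R}^d$ that depend only on $(x_i,x_j)$; they are the statistics of the pairwise exponential family $q_\theta(x)\propto\exp\{\sum_{i\le j}\sum_u\theta_{ij}^u\phi_{ij}^u(x_i,x_j)\}$. Let $m=\max_{i,j} m_{ij}$. The parameter $\theta$ contains each group $\theta_{ij}=\theta_{ji}\in\mathbb{R}^{m_{ij}}$ once, $\|\cdot\|_2$ is its Euclidean norm, and $\theta_{\cdot,i}=(\theta_{ji})_{j\in V}$. Put $a_i(x)=\big(\partial\phi_{ji}/\partial x_i\big)_{j\in V}$, let $A(x)$ be the symmetric matrix with $\theta^\top A(x)\theta=\sum_{i}(a_i(x)^\top\theta_{\cdot,i})^2$, and let $K(x)_{ij}=\partial^2\phi_{ij}/\partial x_i^2+1\{i\ne j\}\,\partial^2\phi_{ij}/\partial x_j^2$, so that $\tfrac12\theta^\top A(x)\theta+K(x)^\top\theta$ is the Hyvärinen score of $q_\theta$. Let $X^1,\dots,X^n$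 be i.i.d. with a distribution $p^*$ on $\mathbb{R}^d$ (not necessarily in the family) for which $K(X)$ is integrable, and put $$\widehat\Gamma=\tfrac1n\sum_r A(X^r),\quad \widehat K=\tfrac1n\sum_r K(X^r),\quad \widehat\Gamma_i=\tfrac1n\sum_r a_i(X^r)a_i(X^r)^\top,$$ with expectations $\Gamma^*,K^*,\Gamma_i^*$. Let $\theta^*=-(\Gamma^*)^{-1}K^*$ and $\kappa_{1,\theta}=\max_{i}\sum_{j\in V,\,u\le m_{ij}}|(\theta^*)_{ij}^u|$. A solution to regularized score matching is any $$\widehat\theta\in\operatorname*{argmin}_\theta\Big\{\tfrac12\theta^\top\widehat\Gamma\theta+\widehat K^\top\theta+\lambda_n\sum_{i,j\in V}\|\theta_{ij}\|_2\Big\}.$$ **Asymptotics and assumptions.** For every $n$ there is such a model; $d$, $m$, the statistics, $p^*$ and a simple graph $(V,E)$ may all vary with $n$. There are positive constants $\underline\epsilon,\bar\epsilon,c_1,c_2,\nu,L,\kappa_0$, not depending on $n$, such that for all $n$: 1. all eigenvalues of $\Gamma_i^*$ lie in $[\underline\epsilon,\bar\epsilon]$, for each $i\in V$; 2. $\theta^*_{ij}=0$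 whenever $i\ne j$ and $(i,j)\notin E$; 3. for $0<t\le\nu$, every entry of $\widehat K$ satisfies $\mathbb{P}(|\widehat K_{ij}^u-(K^*)_{ij}^u|\ge t)\le e^{-c_1nt^2}$, and every entry of $\widehat\Gamma_i$, $i\in V$, deviates from the same entry of $\Gamma_i^*$ by at least $t$ with probability at most $e^{-c_2nt^2}$; 4. $a_i(X)$ is a sub-Gaussian random vector for each $i\in V$: $\mathbb{E}\exp\{\langle v,a_i(X)\rangle^2/L^2\}\le2$ for all unit vectors $v$; 5. $md\ge2$ and $\kappa_{1,\theta}\ge\kappa_0$. **Theorem.** There are constants $C_0,C>0$, depending only on $\underline\epsilon,\bar\epsilon,c_1,c_2,\nu,L,\kappa_0$, such that the following holds for every such sequence of models. If $\lambda_n\asymp\sqrt{m\kappa_{1,\theta}^2\log(md)/n}$ with a sufficiently large constant, that is, for some constant $C_1$ and all large $n$, $$C_0\sqrt{\frac{m\kappa_{1,\theta}^2\log(md)}{n}}\le\lambda_n\le C_1\sqrt{\frac{m\kappa_{1,\theta}^2\log(md)}{n}},$$ and $n\ge C\,md$ for all large $n$, then any solution $\widehat\theta$ to regularized score matching satisfies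 $$\|\widehat\theta-\theta^*\|_2=O_p\left(\sqrt{\frac{(d+|E|)\,m\,\kappa_{1,\theta}^2\log(md)}{n}}\right);$$ that is, for every $\varepsilon>0$ there is an $M$ such that for all large $n$, with probability at least $1-\varepsilon$, every minimizer $\widehat\theta$ satisfies $\|\widehat\theta-\theta^*\|_2\le M\sqrt{(d+|E|)m\kappa_{1,\theta}^2\log(md)/n}$. -/

import Mathlib

open MeasureTheory ProbabilityTheory Filter

namespace ScoreMatching

noncomputable section

/-- The partial derivative `∂f/∂xᵢ`. -/
def partialDeriv {d : ℕ} (i : Fin d) (f : (Fin d → ℝ) → ℝ) (x : Fin d → ℝ) : ℝ :=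
  fderiv ℝ f x (Pi.single i 1)

/-- The sufficient statistics of a pairwise exponential family on `ℝ^d`, with log-density
`∑ θ_{ij}^u φ_{ij}^u` up to an additive constant.  The unordered pair `s(i, j)` carries the
statistics `φ_{ij}^u(x_i, x_j)`, the diagonal pair `s(i, i)` the vertex statistics `φ_i^u(x_i)`.
All of them are twice continuously differentiable, and the number of statistics may vary from
pair to pair. -/
structure PairwiseFamily (d : ℕ) where
  /-- The number of statistics of a vertex or a pair of vertices. -/
  numStat : Sym2 (Fin d) → ℕ
  /-- The statistics. -/
  stat : (e : Sym2 (Fin d)) → Fin (numStat e) → (Fin d → ℝ) → ℝ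
  contDiff_stat : ∀ e u, ContDiff ℝ 2 (stat e u)
  dependsOn_stat : ∀ e u, DependsOn (stat e u) {i | i ∈ e}

namespace PairwiseFamily

variable {d : ℕ} (F : PairwiseFamily d)

/-- `m`, the maximal number of statistics per vertex or pair of vertices. -/
def maxStat : ℕ := Finset.univ.sup F.numStat

/-- Index set of the parameter vector `θ`: every unordered pair occurs once. -/
abbrev ParamIndex : Type := Σ e : Sym2 (Fin d), Fin (F.numStat e)

/-- Index set of the subvector `θ_{·,i}`. -/
abbrev NodeIndex (i : Fin d) : Type := Σ j : Fin d, Fin (F.numStat s(j, i))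

/-- `θ_{·,i} = (θ_{1i}, …, θ_{di})`, where `θ_{ij} = θ_{ji}`. -/
def nodeParam (θ : F.ParamIndex → ℝ) (i : Fin d) : F.NodeIndex i → ℝ :=
  fun k => θ ⟨s(k.1, i), k.2⟩

/-- The group `θ_{ij} ∈ ℝ^{m_{ij}}` of the pair `e = s(i, j)`, as a Euclidean vector. -/
def group (θ : F.ParamIndex → ℝ) (e : Sym2 (Fin d)) : EuclideanSpace ℝ (Fin (F.numStat e)) :=
  WithLp.toLp 2 (fun u => θ ⟨e, u⟩)

/-- `a_i(x) = ∂φ_{·,i}/∂x_i`. -/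
def nodeVec (i : Fin d) (x : Fin d → ℝ) : F.NodeIndex i → ℝ :=
  fun k => partialDeriv i (F.stat s(k.1, i) k.2) x

/-- `A(x)`, the matrix of the quadratic part of the Hyvärinen score
`h(x, θ) = ½ θᵀ A(x) θ + K(x)ᵀ θ`, for which `θᵀ A(x) θ = ∑ᵢ (a_i(x)ᵀ θ_{·,i})²`
(`∂ᵢ φ_k` vanishes if `i` is not in the pair of `k`). -/
def scoreMat (x : Fin d → ℝ) : Matrix F.ParamIndex F.ParamIndex ℝ :=
  Matrix.of fun k l =>
    ∑ i, partialDeriv i (F.stat k.1 k.2) x * partialDeriv i (F.stat l.1 l.2) x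

/-- `K(x)`, with `K_{ij} = ∂²φ_{ij}/∂x_i² + 1{i ≠ j} ∂²φ_{ij}/∂x_j²`. -/
def scoreVec (x : Fin d → ℝ) : F.ParamIndex → ℝ :=
  fun k => ∑ i ∈ k.1.toFinset, partialDeriv i (partialDeriv i (F.stat k.1 k.2)) x

/-! Population quantities, under the distribution `p` of one observation. -/

/-- `Γ* = E[A(X)]`. -/
def popGamma (p : Measure (Fin d → ℝ)) : Matrix F.ParamIndex F.ParamIndex ℝ :=
  Matrix.of fun k l => ∫ x, F.scoreMat x k l ∂p

/-- `K* = E[K(X)]`. -/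
def popK (p : Measure (Fin d → ℝ)) : F.ParamIndex → ℝ :=
  fun k => ∫ x, F.scoreVec x k ∂p

/-- `Γ_i* = E[a_i(X) a_i(X)ᵀ]`. -/
def popNodeGamma (p : Measure (Fin d → ℝ)) (i : Fin d) :
    Matrix (F.NodeIndex i) (F.NodeIndex i) ℝ :=
  Matrix.of fun k l => ∫ x, F.nodeVec i x k * F.nodeVec i x l ∂p

/-- `θ* = -(Γ*)⁻¹ K*`, the minimizer of the expected score. -/
def popParam (p : Measure (Fin d → ℝ)) : F.ParamIndex → ℝ :=
  -Matrix.mulVec (F.popGamma p)⁻¹ (F.popK p)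

/-- `κ_{1,θ} = maxᵢ ∑_{j,u} |(θ*)_{ij}^u|`. -/
def kappa (p : Measure (Fin d → ℝ)) : ℝ :=
  ⨆ i : Fin d, ∑ k : F.NodeIndex i, |F.nodeParam (F.popParam p) i k|

/-! Empirical quantities, for a sample `X^1, …, X^n`. -/

/-- `Γ̂ = n⁻¹ ∑ᵣ A(X^r)`. -/
def empGamma {n : ℕ} (X : Fin n → Fin d → ℝ) : Matrix F.ParamIndex F.ParamIndex ℝ :=
  Matrix.of fun k l => (n : ℝ)⁻¹ * ∑ r, F.scoreMat (X r) k l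

/-- `K̂ = n⁻¹ ∑ᵣ K(X^r)`. -/
def empK {n : ℕ} (X : Fin n → Fin d → ℝ) : F.ParamIndex → ℝ :=
  fun k => (n : ℝ)⁻¹ * ∑ r, F.scoreVec (X r) k

/-- `Γ̂_i = n⁻¹ ∑ᵣ a_i(X^r) a_i(X^r)ᵀ`. -/
def empNodeGamma {n : ℕ} (X : Fin n → Fin d → ℝ) (i : Fin d) :
    Matrix (F.NodeIndex i) (F.NodeIndex i) ℝ :=
  Matrix.of fun k l => (n : ℝ)⁻¹ * ∑ r, F.nodeVec i (X r) k * F.nodeVec i (X r) l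

/-- The group penalty `R(θ) = ∑_{i,j ∈ V} ‖θ_{ij}‖₂`. -/
def penalty (θ : F.ParamIndex → ℝ) : ℝ :=
  ∑ i : Fin d, ∑ j : Fin d, ‖F.group θ s(i, j)‖

/-- The objective `½ θᵀ Γ̂ θ + K̂ᵀ θ + lam R(θ)`. -/
def objective {n : ℕ} (X : Fin n → Fin d → ℝ) (lam : ℝ) (θ : F.ParamIndex → ℝ) : ℝ :=
  1 / 2 * (θ ⬝ᵥ Matrix.mulVec (F.empGamma X) θ) + F.empK X ⬝ᵥ θ + lam * F.penalty θ

/-- `θ` is a solution to regularized score matching. -/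
def IsScoreMatchingSolution {n : ℕ} (X : Fin n → Fin d → ℝ) (lam : ℝ)
    (θ : F.ParamIndex → ℝ) : Prop :=
  ∀ θ' : F.ParamIndex → ℝ, F.objective X lam θ ≤ F.objective X lam θ'

/-- Every eigenvalue of every `Γ_i*` lies in `[lo, hi]`. -/
def EigenvalueBounds (p : Measure (Fin d → ℝ)) (lo hi : ℝ) : Prop :=
  ∀ i : Fin d, ∀ ev : ℝ,
    Module.End.HasEigenvalue (Matrix.toLin' (F.popNodeGamma p i)) ev → lo ≤ ev ∧ ev ≤ hi

/-- `θ_{ij} = 0` for all distinct non-adjacent `i, j`. -/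
def IsSparse (G : SimpleGraph (Fin d)) (θ : F.ParamIndex → ℝ) : Prop :=
  ∀ i j : Fin d, i ≠ j → ¬ G.Adj i j → ‖F.group θ s(i, j)‖ = 0

/-- The tail bounds for the entries of `K̂ - K*` and `Γ̂_i - Γ_i*`. -/
def TailBounds {Ω : Type*} [MeasurableSpace Ω] (μ : Measure Ω) (p : Measure (Fin d → ℝ))
    {n : ℕ} (X : Fin n → Ω → Fin d → ℝ) (c₁ c₂ ν : ℝ) : Prop :=
  (∀ k : F.ParamIndex, ∀ t : ℝ, 0 < t → t ≤ ν →
    μ.real {ω | t ≤ |F.empK (fun r => X r ω) k - F.popK p k|} ≤ Real.exp (-(c₁ * n * t ^ 2))) ∧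
  (∀ i : Fin d, ∀ k l : F.NodeIndex i, ∀ t : ℝ, 0 < t → t ≤ ν →
    μ.real {ω | t ≤ |F.empNodeGamma (fun r => X r ω) i k l - F.popNodeGamma p i k l|} ≤
      Real.exp (-(c₂ * n * t ^ 2)))

end PairwiseFamily

/-- The random vector `Y` is sub-Gaussian, every one-dimensional marginal `⟨v, Y⟩` with `‖v‖₂ = 1`
having `ψ₂`-norm at most `L`. -/
def IsSubGaussianVector {Ω ι : Type*} [MeasurableSpace Ω] [Fintype ι] (Y : Ω → ι → ℝ) (L : ℝ)
    (μ : Measure Ω) : Prop :=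
  ∀ v : ι → ℝ, ‖WithLp.toLp 2 v‖ = 1 →
    ∫⁻ ω, ENNReal.ofReal (Real.exp ((v ⬝ᵥ Y ω) ^ 2 / L ^ 2)) ∂μ ≤ 2

end

end ScoreMatching

namespace ScoreMatching

noncomputable section

namespace PairwiseFamily
variable {d : ℕ} (F : PairwiseFamily d)

theorem partialDeriv_stat_eq_zero {i : Fin d} {e : Sym2 (Fin d)} (h : i ∉ e)
    (u : Fin (F.numStat e)) (x : Fin d → ℝ) : partialDeriv i (F.stat e u) x = 0 := by
  have hd : DifferentiableAt ℝ (F.stat e u) x :=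
    ((F.contDiff_stat e u).differentiable (by norm_num)).differentiableAt
  rw [partialDeriv, ← hd.lineDeriv_eq_fderiv, lineDeriv]
  have : (fun t : ℝ => F.stat e u (x + t • Pi.single i 1)) = fun _ => F.stat e u x := by
    funext t
    apply F.dependsOn_stat e u
    intro j hj
    have : j ≠ i := by rintro rfl; exact h hj
    simp [this]
  rw [this, deriv_const]

/-- The position of the coordinates of `θ_{·,i}` in `θ`. -/
def nodeEmb (i : Fin d) (a : F.NodeIndex i) : F.ParamIndex := ⟨s(a.1, i), a.2⟩

theorem nodeEmb_injective (i : Fin d) : Function.Injective (F.nodeEmb i) := by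
  rintro ⟨j, u⟩ ⟨j', u'⟩ h
  have h1 : s(j, i) = s(j', i) := congrArg Sigma.fst h
  have h2 : j = j' := Sym2.congr_left.1 h1
  subst h2
  simpa [nodeEmb] using h

theorem exists_nodeEmb_eq {i : Fin d} {k : F.ParamIndex} (h : i ∈ k.1) :
    ∃ a, F.nodeEmb i a = k := by
  obtain ⟨e, u⟩ := k
  obtain ⟨j, rfl⟩ := Sym2.mem_iff_exists.1 h
  have := Sym2.eq_swap (a := i) (b := j)
  revert u
  rw [this]
  exact fun u _ => ⟨⟨j, u⟩, rfl⟩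

theorem sum_eq_sum_nodeEmb (i : Fin d) (g : F.ParamIndex → ℝ) (hg : ∀ k, i ∉ k.1 → g k = 0) :
    ∑ k, g k = ∑ a, g (F.nodeEmb i a) := by
  symm
  refine Fintype.sum_of_injective (F.nodeEmb i) (F.nodeEmb_injective i) _ _ ?_ fun _ => rfl
  intro k hk
  exact hg k fun h => hk (F.exists_nodeEmb_eq h)

/-- A sum of matrices, the `i`-th of which lives on the coordinates of `θ_{·,i}`. -/
structure IsNodeSum (T : Matrix F.ParamIndex F.ParamIndex ℝ)
    (D : Fin d → Matrix F.ParamIndex F.ParamIndex ℝ) : Prop where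
  eq_sum : ∀ k l, T k l = ∑ i, D i k l
  eq_zero_left : ∀ i k l, i ∉ k.1 → D i k l = 0
  eq_zero_right : ∀ i k l, i ∉ l.1 → D i k l = 0

variable {F} in
theorem IsNodeSum.mulVec_apply {T : Matrix F.ParamIndex F.ParamIndex ℝ}
    {D : Fin d → Matrix F.ParamIndex F.ParamIndex ℝ} (h : F.IsNodeSum T D)
    (θ : F.ParamIndex → ℝ) (k : F.ParamIndex) :
    Matrix.mulVec T θ k = ∑ i, ∑ a, D i k (F.nodeEmb i a) * F.nodeParam θ i a := by
  simp only [Matrix.mulVec, dotProduct, h.eq_sum, Finset.sum_mul]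
  rw [Finset.sum_comm]
  refine Finset.sum_congr rfl fun i _ => ?_
  exact F.sum_eq_sum_nodeEmb i (fun l => D i k l * θ l) fun l hl => by
    simp [h.eq_zero_right i k l hl]

variable {F} in
theorem IsNodeSum.quadForm {T : Matrix F.ParamIndex F.ParamIndex ℝ}
    {D : Fin d → Matrix F.ParamIndex F.ParamIndex ℝ} (h : F.IsNodeSum T D)
    (θ : F.ParamIndex → ℝ) :
    θ ⬝ᵥ Matrix.mulVec T θ = ∑ i, F.nodeParam θ i ⬝ᵥ
      Matrix.mulVec ((D i).submatrix (F.nodeEmb i) (F.nodeEmb i)) (F.nodeParam θ i) := by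
  simp only [dotProduct, h.mulVec_apply, Finset.mul_sum (s := (Finset.univ : Finset (Fin d)))]
  rw [Finset.sum_comm]
  refine Finset.sum_congr rfl fun i _ => ?_
  refine (F.sum_eq_sum_nodeEmb i
    (fun k => θ k * ∑ a, D i k (F.nodeEmb i a) * F.nodeParam θ i a) fun k hk => ?_)
  simp [h.eq_zero_left i k _ hk]

theorem card_filter_mem_le (e : Sym2 (Fin d)) :
    (Finset.univ.filter fun i => i ∈ e).card ≤ 2 := by
  induction e with
  | h a b =>
    refine le_trans (Finset.card_le_card (t := {a, b}) ?_) Finset.card_le_two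
    intro i
    simp

variable {F} in
theorem IsNodeSum.abs_mulVec_le {T : Matrix F.ParamIndex F.ParamIndex ℝ}
    {D : Fin d → Matrix F.ParamIndex F.ParamIndex ℝ} (h : F.IsNodeSum T D)
    {θ : F.ParamIndex → ℝ} {t κ : ℝ} (ht : 0 ≤ t) (hκ : ∀ i, ∑ a, |F.nodeParam θ i a| ≤ κ)
    (hD : ∀ i a b, |D i (F.nodeEmb i a) (F.nodeEmb i b)| ≤ t) (k : F.ParamIndex) :
    |Matrix.mulVec T θ k| ≤ 2 * (t * κ) := by
  rw [h.mulVec_apply, ← Finset.sum_filter_of_ne (p := fun i => i ∈ k.1)]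
  · refine (Finset.abs_sum_le_sum_abs _ _).trans ?_
    have key : ∀ i ∈ Finset.univ.filter (fun i => i ∈ k.1),
        |∑ a, D i k (F.nodeEmb i a) * F.nodeParam θ i a| ≤ t * κ := by
      intro i hi
      obtain ⟨b, rfl⟩ := F.exists_nodeEmb_eq (Finset.mem_filter.1 hi).2
      refine (Finset.abs_sum_le_sum_abs _ _).trans ?_
      calc _ ≤ ∑ a, t * |F.nodeParam θ i a| := by
            refine Finset.sum_le_sum fun a _ => ?_
            rw [abs_mul]
            exact mul_le_mul_of_nonneg_right (hD i b a) (abs_nonneg _)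
        _ ≤ _ := by
            rw [← Finset.mul_sum]
            exact mul_le_mul_of_nonneg_left (hκ i) ht
    refine (Finset.sum_le_card_nsmul _ _ _ key).trans ?_
    rw [nsmul_eq_mul]
    rcases (Finset.univ.filter fun i => i ∈ k.1).eq_empty_or_nonempty with h0 | ⟨i, hi⟩
    · rw [h0]
      have hk : ∃ i, i ∈ k.1 := by
        obtain ⟨e, u⟩ := k
        induction e with | h a b => exact ⟨a, by simp⟩
      obtain ⟨i, hi⟩ := hk
      have : i ∈ (Finset.univ.filter fun i => i ∈ k.1) := by simp [hi]
      simp [h0] at this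
    · have h1 : 0 ≤ t * κ := (abs_nonneg _).trans (key i hi)
      refine mul_le_mul_of_nonneg_right ?_ h1
      exact_mod_cast card_filter_mem_le k.1
  · intro i _ hne
    by_contra hi
    exact hne (Finset.sum_eq_zero fun a _ => by simp [h.eq_zero_left i k _ hi])

theorem sum_sym2_le (f : Sym2 (Fin d) → ℝ) (hf : ∀ e, 0 ≤ f e) :
    ∑ e, f e ≤ ∑ i, ∑ j, f s(i, j) := by
  classical
  rw [← Fintype.sum_prod_type' (f := fun i j => f s(i, j))]
  have hinj : Function.Injective (fun e : Sym2 (Fin d) => (Quot.out e : Fin d × Fin d)) :=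
    Function.LeftInverse.injective (g := Quot.mk _) fun e => Quot.out_eq e
  calc ∑ e, f e = ∑ e, (fun q : Fin d × Fin d => f s(q.1, q.2)) (Quot.out e) := by
        refine Finset.sum_congr rfl fun e _ => ?_
        congr 1
        exact (Quot.out_eq e).symm
    _ = ∑ q ∈ Finset.univ.image (fun e : Sym2 (Fin d) => (Quot.out e : Fin d × Fin d)),
          f s(q.1, q.2) := by
        rw [Finset.sum_image fun _ _ _ _ h => hinj h]
    _ ≤ _ := Finset.sum_le_sum_of_subset_of_nonneg (Finset.subset_univ _) fun _ _ _ => hf _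

/-- `∑_{i,j ∈ V} ‖θ_{ij}‖²`, in which the groups of distinct vertices are counted twice. -/
def pairNormSq (θ : F.ParamIndex → ℝ) : ℝ := ∑ i : Fin d, ∑ j : Fin d, ‖F.group θ s(i, j)‖ ^ 2

theorem norm_group_sq (θ : F.ParamIndex → ℝ) (e : Sym2 (Fin d)) :
    ‖F.group θ e‖ ^ 2 = ∑ u, θ ⟨e, u⟩ ^ 2 := by
  simp [group, EuclideanSpace.norm_sq_eq]

theorem norm_sq_le_pairNormSq (θ : F.ParamIndex → ℝ) :
    ‖WithLp.toLp 2 θ‖ ^ 2 ≤ F.pairNormSq θ := by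
  rw [EuclideanSpace.norm_sq_eq]
  simp only [Real.norm_eq_abs, sq_abs]
  rw [Fintype.sum_sigma]
  refine le_trans (le_of_eq ?_) (sum_sym2_le (fun e => ‖F.group θ e‖ ^ 2) fun e => sq_nonneg _)
  simp only [norm_group_sq]

theorem pairNormSq_eq_sum_nodeParam (θ : F.ParamIndex → ℝ) :
    F.pairNormSq θ = ∑ i, ∑ a, F.nodeParam θ i a ^ 2 := by
  rw [pairNormSq, Finset.sum_comm]
  refine Finset.sum_congr rfl fun i _ => ?_
  rw [Fintype.sum_sigma]
  exact Finset.sum_congr rfl fun j _ => F.norm_group_sq θ _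

theorem pairNormSq_nonneg (θ : F.ParamIndex → ℝ) : 0 ≤ F.pairNormSq θ :=
  Finset.sum_nonneg fun _ _ => Finset.sum_nonneg fun _ _ => sq_nonneg _

theorem numStat_le (e : Sym2 (Fin d)) : F.numStat e ≤ F.maxStat :=
  Finset.le_sup (f := F.numStat) (Finset.mem_univ e)

theorem abs_dotProduct_le_penalty {g : F.ParamIndex → ℝ} {b : ℝ} (hb : 0 ≤ b)
    (hg : ∀ k, |g k| ≤ b) (θ : F.ParamIndex → ℝ) :
    |g ⬝ᵥ θ| ≤ √F.maxStat * b * F.penalty θ := by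
  have h1 : ∀ e, |∑ u, g ⟨e, u⟩ * θ ⟨e, u⟩| ≤ √F.maxStat * b * ‖F.group θ e‖ := by
    intro e
    have hcs := Finset.sum_mul_sq_le_sq_mul_sq Finset.univ (fun u => g ⟨e, u⟩)
      (fun u => θ ⟨e, u⟩)
    rw [← F.norm_group_sq θ e] at hcs
    have hgs : ∑ u, g ⟨e, u⟩ ^ 2 ≤ (√F.maxStat * b) ^ 2 := by
      calc ∑ u, g ⟨e, u⟩ ^ 2 ≤ ∑ _u : Fin (F.numStat e), b ^ 2 :=
            Finset.sum_le_sum fun u _ =>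
              sq_le_sq' (abs_le.1 (hg ⟨e, u⟩)).1 (abs_le.1 (hg ⟨e, u⟩)).2
        _ = F.numStat e * b ^ 2 := by simp
        _ ≤ F.maxStat * b ^ 2 := by
            have := F.numStat_le e
            gcongr
        _ = _ := by rw [mul_pow, Real.sq_sqrt (by positivity)]
    refine abs_le.2 (abs_le_of_sq_le_sq' ?_ (by positivity))
    refine hcs.trans ?_
    rw [mul_pow]
    gcongr
  rw [dotProduct, Fintype.sum_sigma]
  refine (Finset.abs_sum_le_sum_abs _ _).trans ?_
  refine (Finset.sum_le_sum (g := fun e => √F.maxStat * b * ‖F.group θ e‖)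
    fun e _ => h1 e).trans ?_
  rw [← Finset.mul_sum]
  refine mul_le_mul_of_nonneg_left ?_ (by positivity)
  exact sum_sym2_le _ fun e => norm_nonneg _

theorem group_sub (θ θ' : F.ParamIndex → ℝ) (e : Sym2 (Fin d)) :
    F.group (θ - θ') e = F.group θ e - F.group θ' e := rfl

theorem penalty_eq_sum_prod (θ : F.ParamIndex → ℝ) :
    F.penalty θ = ∑ q : Fin d × Fin d, ‖F.group θ s(q.1, q.2)‖ :=
  (Fintype.sum_prod_type' (f := fun i j => ‖F.group θ s(i, j)‖)).symm

theorem pairNormSq_eq_sum_prod (θ : F.ParamIndex → ℝ) :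
    F.pairNormSq θ = ∑ q : Fin d × Fin d, ‖F.group θ s(q.1, q.2)‖ ^ 2 :=
  (Fintype.sum_prod_type' (f := fun i j => ‖F.group θ s(i, j)‖ ^ 2)).symm

theorem sum_norm_group_le (θ : F.ParamIndex → ℝ) (S : Finset (Fin d × Fin d)) :
    ∑ q ∈ S, ‖F.group θ s(q.1, q.2)‖ ≤ √S.card * √(F.pairNormSq θ) := by
  rw [← Real.sqrt_mul (by positivity)]
  refine Real.le_sqrt_of_sq_le ?_
  refine sq_sum_le_card_mul_sum_sq.trans ?_
  rw [pairNormSq_eq_sum_prod]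
  refine mul_le_mul_of_nonneg_left ?_ (by positivity)
  exact Finset.sum_le_sum_of_subset_of_nonneg (Finset.subset_univ _) fun q _ _ => sq_nonneg _

theorem penalty_le (θ : F.ParamIndex → ℝ) : F.penalty θ ≤ d * √(F.pairNormSq θ) := by
  have := F.sum_norm_group_le θ Finset.univ
  rw [← penalty_eq_sum_prod] at this
  refine this.trans_eq ?_
  congr 1
  simp

/-- The pairs `(i, i)` and the ordered edges. -/
def edgePairs (G : SimpleGraph (Fin d)) : Finset (Fin d × Fin d) :=
  open Classical in Finset.univ.filter fun q => q.1 = q.2 ∨ G.Adj q.1 q.2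

theorem card_edgePairs_le (G : SimpleGraph (Fin d)) :
    ((edgePairs G).card : ℝ) ≤ 2 * (d + G.edgeSet.ncard) := by
  classical
  have h1 : (edgePairs G).card ≤ d + 2 * G.edgeSet.ncard := by
    have h2 : edgePairs G ⊆ Finset.univ.image (fun i : Fin d => (i, i)) ∪
        Finset.univ.image (fun q : G.Dart => q.toProd) := by
      rintro ⟨i, j⟩ hq
      rcases (Finset.mem_filter.1 hq).2 with h | h
      · simp only at h; simp [h]
      · refine Finset.mem_union_right _ (Finset.mem_image.2 ⟨⟨(i, j), h⟩, by simp⟩)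
    refine (Finset.card_le_card h2).trans ((Finset.card_union_le _ _).trans ?_)
    gcongr
    · exact Finset.card_image_le.trans (by simp)
    · refine Finset.card_image_le.trans ?_
      rw [Finset.card_univ, G.dart_card_eq_twice_card_edges, Set.ncard_eq_toFinset_card',
        SimpleGraph.edgeFinset]
  have : ((edgePairs G).card : ℝ) ≤ d + 2 * G.edgeSet.ncard := by exact_mod_cast h1
  linarith [(Nat.cast_nonneg d : (0 : ℝ) ≤ d)]

theorem penalty_sub_le {G : SimpleGraph (Fin d)} {θ₀ : F.ParamIndex → ℝ}
    (hG : F.IsSparse G θ₀) (θ : F.ParamIndex → ℝ) :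
    F.penalty θ₀ - F.penalty θ ≤
      2 * ∑ q ∈ edgePairs G, ‖F.group (θ - θ₀) s(q.1, q.2)‖ - F.penalty (θ - θ₀) := by
  classical
  have hsum : ∑ q ∈ edgePairs G, ‖F.group (θ - θ₀) s(q.1, q.2)‖ =
      ∑ q : Fin d × Fin d, if q ∈ edgePairs G then ‖F.group (θ - θ₀) s(q.1, q.2)‖ else 0 := by
    simp
  rw [hsum, penalty_eq_sum_prod, penalty_eq_sum_prod, penalty_eq_sum_prod,
    ← Finset.sum_sub_distrib, Finset.mul_sum, ← Finset.sum_sub_distrib]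
  refine Finset.sum_le_sum fun q _ => ?_
  rw [group_sub]
  split_ifs with hq
  · have := norm_sub_norm_le (F.group θ₀ s(q.1, q.2)) (F.group θ s(q.1, q.2))
    rw [norm_sub_rev] at this
    linarith
  · have h0 : F.group θ₀ s(q.1, q.2) = 0 := by
      simp only [edgePairs, Finset.mem_filter, Finset.mem_univ, true_and, not_or] at hq
      exact norm_eq_zero.1 (hG _ _ hq.1 hq.2)
    simp [h0]

/-- The matrix with entries `n⁻¹ ∑ᵣ ∂ᵢφ_k(X^r) ∂ᵢφ_l(X^r)`. -/
def empDerivGamma {n : ℕ} (X : Fin n → Fin d → ℝ) (i : Fin d) :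
    Matrix F.ParamIndex F.ParamIndex ℝ :=
  Matrix.of fun k l => (n : ℝ)⁻¹ *
    ∑ r, partialDeriv i (F.stat k.1 k.2) (X r) * partialDeriv i (F.stat l.1 l.2) (X r)

/-- The matrix with entries `E[∂ᵢφ_k(X) ∂ᵢφ_l(X)]`. -/
def popDerivGamma (p : Measure (Fin d → ℝ)) (i : Fin d) :
    Matrix F.ParamIndex F.ParamIndex ℝ :=
  Matrix.of fun k l =>
    ∫ x, partialDeriv i (F.stat k.1 k.2) x * partialDeriv i (F.stat l.1 l.2) x ∂p

theorem isNodeSum_empGamma {n : ℕ} (X : Fin n → Fin d → ℝ) :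
    F.IsNodeSum (F.empGamma X) (F.empDerivGamma X) where
  eq_sum k l := by
    simp only [empGamma, empDerivGamma, scoreMat, Matrix.of_apply, ← Finset.mul_sum]
    rw [Finset.sum_comm]
  eq_zero_left i k l h := by
    simp [empDerivGamma, F.partialDeriv_stat_eq_zero h]
  eq_zero_right i k l h := by
    simp [empDerivGamma, F.partialDeriv_stat_eq_zero h]

theorem integrable_partialDeriv_mul {p : Measure (Fin d → ℝ)}
    (hint : ∀ i a b, Integrable (fun x => F.nodeVec i x a * F.nodeVec i x b) p)
    (i : Fin d) (k l : F.ParamIndex) :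
    Integrable (fun x =>
      partialDeriv i (F.stat k.1 k.2) x * partialDeriv i (F.stat l.1 l.2) x) p := by
  by_cases hk : i ∈ k.1
  · by_cases hl : i ∈ l.1
    · obtain ⟨a, rfl⟩ := F.exists_nodeEmb_eq hk
      obtain ⟨b, rfl⟩ := F.exists_nodeEmb_eq hl
      exact hint i a b
    · simp [F.partialDeriv_stat_eq_zero hl]
  · simp [F.partialDeriv_stat_eq_zero hk]

theorem isNodeSum_popGamma {p : Measure (Fin d → ℝ)}
    (hint : ∀ i a b, Integrable (fun x => F.nodeVec i x a * F.nodeVec i x b) p) :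
    F.IsNodeSum (F.popGamma p) (F.popDerivGamma p) where
  eq_sum k l := by
    simp only [popGamma, popDerivGamma, scoreMat, Matrix.of_apply]
    exact integral_finsetSum _ fun i _ => F.integrable_partialDeriv_mul hint i k l
  eq_zero_left i k l h := by
    simp [popDerivGamma, F.partialDeriv_stat_eq_zero h]
  eq_zero_right i k l h := by
    simp [popDerivGamma, F.partialDeriv_stat_eq_zero h]

variable {F} in
theorem IsNodeSum.sub {T T' : Matrix F.ParamIndex F.ParamIndex ℝ}
    {D D' : Fin d → Matrix F.ParamIndex F.ParamIndex ℝ} (h : F.IsNodeSum T D)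
    (h' : F.IsNodeSum T' D') : F.IsNodeSum (T - T') (D - D') where
  eq_sum k l := by simp [h.eq_sum, h'.eq_sum]
  eq_zero_left i k l hk := by simp [h.eq_zero_left i k l hk, h'.eq_zero_left i k l hk]
  eq_zero_right i k l hk := by simp [h.eq_zero_right i k l hk, h'.eq_zero_right i k l hk]

theorem popGamma_mulVec_popParam {p : Measure (Fin d → ℝ)} {lo : ℝ} (hlo : 0 < lo)
    (hint : ∀ i a b, Integrable (fun x => F.nodeVec i x a * F.nodeVec i x b) p)
    (hquad : ∀ i v, lo * ∑ a, v a ^ 2 ≤ v ⬝ᵥ Matrix.mulVec (F.popNodeGamma p i) v) :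
    Matrix.mulVec (F.popGamma p) (F.popParam p) = -F.popK p := by
  have hinj : Function.Injective (F.popGamma p).mulVec := by
    rw [← Matrix.coe_mulVecLin, ← LinearMap.ker_eq_bot, LinearMap.ker_eq_bot']
    intro θ hθ
    rw [Matrix.mulVecLin_apply] at hθ
    have h1 := (F.isNodeSum_popGamma hint).quadForm θ
    rw [hθ, dotProduct_zero] at h1
    have h2 : lo * F.pairNormSq θ ≤ 0 := by
      rw [h1, pairNormSq_eq_sum_nodeParam, Finset.mul_sum]
      exact Finset.sum_le_sum fun i _ => hquad i _
    have h3 := F.norm_sq_le_pairNormSq θ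
    have h4 : ‖WithLp.toLp 2 θ‖ ^ 2 ≤ 0 := by nlinarith
    have h5 : WithLp.toLp 2 θ = 0 := by
      rw [← norm_eq_zero]; exact pow_eq_zero_iff (two_ne_zero) |>.1 (le_antisymm h4 (sq_nonneg _))
    simpa using h5
  have hunit : IsUnit (F.popGamma p) := Matrix.mulVec_injective_iff_isUnit.1 hinj
  rw [popParam, Matrix.mulVec_neg, Matrix.mulVec_mulVec,
    Matrix.mul_nonsing_inv _ ((Matrix.isUnit_iff_isUnit_det _).1 hunit), Matrix.one_mulVec]

theorem sum_abs_nodeParam_le_kappa (p : Measure (Fin d → ℝ)) (i : Fin d) :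
    ∑ a, |F.nodeParam (F.popParam p) i a| ≤ F.kappa p :=
  le_ciSup (f := fun i => ∑ a, |F.nodeParam (F.popParam p) i a|)
    (Set.finite_range _).bddAbove i

theorem abs_score_gradient_le {p : Measure (Fin d → ℝ)} {lo t : ℝ} (hlo : 0 < lo) (ht : 0 ≤ t)
    (hint : ∀ i a b, Integrable (fun x => F.nodeVec i x a * F.nodeVec i x b) p)
    (hquad : ∀ i v, lo * ∑ a, v a ^ 2 ≤ v ⬝ᵥ Matrix.mulVec (F.popNodeGamma p i) v)
    {n : ℕ} (X : Fin n → Fin d → ℝ) (hK : ∀ k, |F.empK X k - F.popK p k| ≤ t)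
    (hΓ : ∀ i a b, |F.empNodeGamma X i a b - F.popNodeGamma p i a b| ≤ t) (k : F.ParamIndex) :
    |(Matrix.mulVec (F.empGamma X) (F.popParam p) + F.empK X) k| ≤ 2 * (t * F.kappa p) + t := by
  have h1 := ((F.isNodeSum_empGamma X).sub (F.isNodeSum_popGamma hint)).abs_mulVec_le ht
    (F.sum_abs_nodeParam_le_kappa p) hΓ k
  rw [Matrix.sub_mulVec, F.popGamma_mulVec_popParam hlo hint hquad] at h1
  calc _ = |(Matrix.mulVec (F.empGamma X) (F.popParam p) - -F.popK p) k
        + (F.empK X k - F.popK p k)| := by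
        congr 1
        simp only [Pi.add_apply, Pi.sub_apply, Pi.neg_apply]
        ring
    _ ≤ _ := (abs_add_le _ _).trans (add_le_add h1 (hK k))

theorem empGamma_isSymm {n : ℕ} (X : Fin n → Fin d → ℝ) : (F.empGamma X).IsSymm := by
  ext k l
  simp only [empGamma, scoreMat, Matrix.transpose_apply, Matrix.of_apply]
  simp_rw [mul_comm (partialDeriv _ (F.stat l.1 l.2) _)]

theorem objective_sub {n : ℕ} (X : Fin n → Fin d → ℝ) (lam : ℝ) (θ θ₀ : F.ParamIndex → ℝ) :
    F.objective X lam θ - F.objective X lam θ₀ =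
      1 / 2 * ((θ - θ₀) ⬝ᵥ Matrix.mulVec (F.empGamma X) (θ - θ₀)) +
        (Matrix.mulVec (F.empGamma X) θ₀ + F.empK X) ⬝ᵥ (θ - θ₀) +
        lam * (F.penalty θ - F.penalty θ₀) := by
  have hs : θ₀ ⬝ᵥ Matrix.mulVec (F.empGamma X) θ = θ ⬝ᵥ Matrix.mulVec (F.empGamma X) θ₀ := by
    rw [Matrix.dotProduct_mulVec, ← Matrix.mulVec_transpose, (F.empGamma_isSymm X).eq,
      dotProduct_comm]
  simp only [objective, Matrix.mulVec_sub, dotProduct_sub, sub_dotProduct, add_dotProduct,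
    dotProduct_comm (Matrix.mulVec (F.empGamma X) θ₀), hs]
  ring

variable {F} in
theorem IsScoreMatchingSolution.pairNormSq_le {n : ℕ} {X : Fin n → Fin d → ℝ} {lam lo b : ℝ}
    {θ θ₀ : F.ParamIndex → ℝ} (h : F.IsScoreMatchingSolution X lam θ)
    (hquad : ∀ i v, lo / 2 * ∑ a, v a ^ 2 ≤ v ⬝ᵥ Matrix.mulVec (F.empNodeGamma X i) v)
    (hb : 0 ≤ b) (hg : ∀ k, |(Matrix.mulVec (F.empGamma X) θ₀ + F.empK X) k| ≤ b) :
    lo / 4 * F.pairNormSq (θ - θ₀) ≤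
      √F.maxStat * b * F.penalty (θ - θ₀) + lam * (F.penalty θ₀ - F.penalty θ) := by
  have h1 := F.objective_sub X lam θ θ₀
  have h2 := h θ₀
  have h3 := (abs_le.1 (F.abs_dotProduct_le_penalty hb hg (θ - θ₀))).1
  have h4 : lo / 2 * F.pairNormSq (θ - θ₀) ≤
      (θ - θ₀) ⬝ᵥ Matrix.mulVec (F.empGamma X) (θ - θ₀) := by
    rw [(F.isNodeSum_empGamma X).quadForm, pairNormSq_eq_sum_nodeParam, Finset.mul_sum]
    exact Finset.sum_le_sum fun i _ => hquad i _
  linarith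

theorem sqrt_le_of_mul_le_mul_sqrt {c B Q : ℝ} (hc : 0 < c) (hQ : 0 ≤ Q) (hB : 0 ≤ B)
    (h : c * Q ≤ B * √Q) : √Q ≤ B / c := by
  rw [le_div_iff₀ hc]
  rcases (Real.sqrt_nonneg Q).eq_or_lt with h0 | h0
  · rw [← h0]; simpa using hB
  · nlinarith [Real.mul_self_sqrt hQ]

theorem norm_le_sqrt_pairNormSq (θ : F.ParamIndex → ℝ) :
    ‖WithLp.toLp 2 θ‖ ≤ √(F.pairNormSq θ) :=
  Real.le_sqrt_of_sq_le (F.norm_sq_le_pairNormSq θ)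

theorem penalty_nonneg (θ : F.ParamIndex → ℝ) : 0 ≤ F.penalty θ :=
  Finset.sum_nonneg fun _ _ => Finset.sum_nonneg fun _ _ => norm_nonneg _

variable {F} in
/-- The error bound when the penalty dominates the noise. -/
theorem IsScoreMatchingSolution.norm_sub_le_of_dominated {n : ℕ} {X : Fin n → Fin d → ℝ}
    {lam lo b : ℝ} {G : SimpleGraph (Fin d)} {θ θ₀ : F.ParamIndex → ℝ} (hlo : 0 < lo)
    (h : F.IsScoreMatchingSolution X lam θ)
    (hquad : ∀ i v, lo / 2 * ∑ a, v a ^ 2 ≤ v ⬝ᵥ Matrix.mulVec (F.empNodeGamma X i) v)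
    (hb : 0 ≤ b) (hg : ∀ k, |(Matrix.mulVec (F.empGamma X) θ₀ + F.empK X) k| ≤ b)
    (hG : F.IsSparse G θ₀) (hlam : √F.maxStat * b ≤ lam) :
    ‖WithLp.toLp 2 (θ - θ₀)‖ ≤ 16 * lam / lo * √(d + G.edgeSet.ncard) := by
  have hlam0 : 0 ≤ lam := le_trans (by positivity) hlam
  have h1 := h.pairNormSq_le hquad hb hg
  have h2 := mul_le_mul_of_nonneg_left (F.penalty_sub_le hG θ) hlam0
  have h3 := mul_le_mul_of_nonneg_right hlam (F.penalty_nonneg (θ - θ₀))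
  have h4 := F.sum_norm_group_le (θ - θ₀) (edgePairs G)
  have h5 : √(edgePairs G).card ≤ 2 * √(d + G.edgeSet.ncard) := by
    refine Real.sqrt_le_iff.2 ⟨by positivity, ?_⟩
    rw [mul_pow, Real.sq_sqrt (by positivity)]
    have h0 : (0 : ℝ) ≤ d + G.edgeSet.ncard := by positivity
    linarith [card_edgePairs_le G]
  have h6 : lo / 4 * F.pairNormSq (θ - θ₀) ≤
      4 * lam * √(d + G.edgeSet.ncard) * √(F.pairNormSq (θ - θ₀)) := by
    have h7 := mul_le_mul_of_nonneg_left (h4.trans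
      (mul_le_mul_of_nonneg_right h5 (Real.sqrt_nonneg (F.pairNormSq (θ - θ₀))))) hlam0
    linarith
  refine (F.norm_le_sqrt_pairNormSq _).trans ?_
  refine (sqrt_le_of_mul_le_mul_sqrt (by positivity) (F.pairNormSq_nonneg _) (by positivity)
    h6).trans_eq ?_
  field_simp
  ring

variable {F} in
/-- The error bound that ignores sparsity. -/
theorem IsScoreMatchingSolution.norm_sub_le {n : ℕ} {X : Fin n → Fin d → ℝ}
    {lam lo b : ℝ} {θ θ₀ : F.ParamIndex → ℝ} (hlo : 0 < lo)
    (h : F.IsScoreMatchingSolution X lam θ)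
    (hquad : ∀ i v, lo / 2 * ∑ a, v a ^ 2 ≤ v ⬝ᵥ Matrix.mulVec (F.empNodeGamma X i) v)
    (hb : 0 ≤ b) (hg : ∀ k, |(Matrix.mulVec (F.empGamma X) θ₀ + F.empK X) k| ≤ b)
    (hlam : 0 ≤ lam) :
    ‖WithLp.toLp 2 (θ - θ₀)‖ ≤ 4 * (√F.maxStat * b + lam) * d / lo := by
  have h1 := h.pairNormSq_le hquad hb hg
  have h2 : F.penalty θ₀ - F.penalty θ ≤ F.penalty (θ - θ₀) := by
    rw [penalty_eq_sum_prod, penalty_eq_sum_prod, penalty_eq_sum_prod, ← Finset.sum_sub_distrib]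
    refine Finset.sum_le_sum fun q _ => ?_
    rw [group_sub, norm_sub_rev]
    exact norm_sub_norm_le _ _
  have h3 : lo / 4 * F.pairNormSq (θ - θ₀) ≤
      (√F.maxStat * b + lam) * d * √(F.pairNormSq (θ - θ₀)) := by
    have h4 := mul_le_mul_of_nonneg_left h2 hlam
    have h5 := mul_le_mul_of_nonneg_left (F.penalty_le (θ - θ₀))
      (show 0 ≤ √F.maxStat * b + lam by positivity)
    linarith
  refine (F.norm_le_sqrt_pairNormSq _).trans ?_
  refine (sqrt_le_of_mul_le_mul_sqrt (by positivity) (F.pairNormSq_nonneg _) (by positivity)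
    h3).trans_eq ?_
  field_simp

theorem popNodeGamma_quadForm_ge {p : Measure (Fin d → ℝ)} {lo hi : ℝ}
    (h : F.EigenvalueBounds p lo hi) (i : Fin d) (v : F.NodeIndex i → ℝ) :
    lo * ∑ a, v a ^ 2 ≤ v ⬝ᵥ Matrix.mulVec (F.popNodeGamma p i) v := by
  classical
  have hH : (F.popNodeGamma p i - lo • (1 : Matrix _ _ ℝ)).IsHermitian := by
    refine Matrix.IsHermitian.sub ?_ (Matrix.isHermitian_one.smul (by simp [IsSelfAdjoint]))
    ext a b
    simp [popNodeGamma, mul_comm]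
  have hP : (F.popNodeGamma p i - lo • (1 : Matrix _ _ ℝ)).PosSemidef := by
    rw [hH.posSemidef_iff_eigenvalues_nonneg]
    intro j
    have hev := hH.mulVec_eigenvectorBasis j
    have hne : (WithLp.ofLp (hH.eigenvectorBasis j)) ≠ 0 := by
      intro h0
      exact hH.eigenvectorBasis.toBasis.ne_zero j (by ext a; simpa using congrFun h0 a)
    have h1 : Module.End.HasEigenvalue (Matrix.toLin' (F.popNodeGamma p i))
        (hH.eigenvalues j + lo) := by
      refine Module.End.hasEigenvalue_of_hasEigenvector
        (x := WithLp.ofLp (hH.eigenvectorBasis j)) ⟨?_, hne⟩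
      rw [Module.End.mem_eigenspace_iff, Matrix.toLin'_apply]
      rw [Matrix.sub_mulVec, Matrix.smul_mulVec, Matrix.one_mulVec] at hev
      rw [add_smul, ← hev, sub_add_cancel]
    simpa using (h i _ h1).1
  have h2 := hP.dotProduct_mulVec_nonneg v
  rw [Matrix.sub_mulVec, Matrix.smul_mulVec, Matrix.one_mulVec, dotProduct_sub,
    dotProduct_smul] at h2
  have h3 : v ⬝ᵥ v = ∑ a, v a ^ 2 := by simp [dotProduct, sq]
  simp only [star_trivial, h3, smul_eq_mul] at h2
  linarith

end PairwiseFamily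

theorem exists_half_net_sphere (E : Type*) [NormedAddCommGroup E] [NormedSpace ℝ E]
    [FiniteDimensional ℝ E] :
    ∃ s : Finset E, s.card ≤ 5 ^ Module.finrank ℝ E ∧ (∀ x ∈ s, ‖x‖ = 1) ∧
      ∀ x, ‖x‖ = 1 → ∃ y ∈ s, ‖x - y‖ < 1 / 2 := by
  classical
  let P : Finset E → Prop := fun s =>
    (∀ x ∈ s, ‖x‖ = 1) ∧ ∀ x ∈ s, ∀ y ∈ s, x ≠ y → 1 / 2 ≤ ‖x - y‖
  have hcard : ∀ s, P s → s.card ≤ 5 ^ Module.finrank ℝ E := by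
    intro s hs
    have hinj : Function.Injective fun x : E => (2 : ℝ) • x := smul_right_injective E two_ne_zero
    rw [← Finset.card_image_of_injective s hinj]
    apply Besicovitch.card_le_of_separated
    · intro c hc
      obtain ⟨x, hx, rfl⟩ := Finset.mem_image.1 hc
      simp [norm_smul, hs.1 x hx]
    · intro c hc c' hc' hne
      obtain ⟨x, hx, rfl⟩ := Finset.mem_image.1 hc
      obtain ⟨y, hy, rfl⟩ := Finset.mem_image.1 hc'
      have := hs.2 x hx y hy fun h => hne (by rw [h])
      rw [← smul_sub, norm_smul, Real.norm_two]
      linarith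
  have hne : {k | ∃ s, P s ∧ s.card = k}.Nonempty := ⟨0, ∅, by simp [P], rfl⟩
  have hbdd : BddAbove {k | ∃ s, P s ∧ s.card = k} :=
    ⟨_, by rintro k ⟨s, hs, rfl⟩; exact hcard s hs⟩
  obtain ⟨s, hs, hmax⟩ := Nat.sSup_mem hne hbdd
  refine ⟨s, hcard s hs, hs.1, fun x hx => ?_⟩
  by_contra! hfar
  have hxs : x ∉ s := fun h => by have := hfar x h; norm_num at this
  have hins : P (insert x s) := by
    refine ⟨?_, ?_⟩
    · intro y hy
      rcases Finset.mem_insert.1 hy with rfl | hy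
      exacts [hx, hs.1 y hy]
    · intro y hy z hz hyz
      rcases Finset.mem_insert.1 hy with hy | hy <;> rcases Finset.mem_insert.1 hz with hz | hz
      · exact absurd (hy.trans hz.symm) hyz
      · rw [hy]; exact hfar z hz
      · rw [hz, norm_sub_rev]; exact hfar y hy
      · exact hs.2 y hy z hz hyz
  have := le_csSup hbdd ⟨_, hins, rfl⟩
  rw [Finset.card_insert_of_notMem hxs, ← hmax] at this
  omega

theorem norm_toLp_sq_eq_dotProduct {ι : Type*} [Fintype ι] (v : ι → ℝ) :
    ‖WithLp.toLp 2 v‖ ^ 2 = v ⬝ᵥ v := by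
  rw [EuclideanSpace.norm_sq_eq]
  simp [dotProduct, sq]

/-- A quadratic form is controlled by its values on a finite set of unit vectors. -/
theorem exists_finset_quadForm_le (ι : Type*) [Fintype ι] :
    ∃ s : Finset (ι → ℝ), s.card ≤ 5 ^ Fintype.card ι ∧ (∀ v ∈ s, ‖WithLp.toLp 2 v‖ = 1) ∧
      ∀ (M : Matrix ι ι ℝ) (t : ℝ), (∀ v ∈ s, |v ⬝ᵥ Matrix.mulVec M v| ≤ t) →
        ∀ v, |v ⬝ᵥ Matrix.mulVec M v| ≤ 32 * t * (v ⬝ᵥ v) := by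
  classical
  obtain ⟨s, hcard, hs1, hs2⟩ := exists_half_net_sphere (EuclideanSpace ℝ ι)
  refine ⟨s.image WithLp.ofLp, ?_, ?_, ?_⟩
  · refine Finset.card_image_le.trans ?_
    simpa using hcard
  · intro v hv
    obtain ⟨x, hx, rfl⟩ := Finset.mem_image.1 hv
    exact hs1 x hx
  intro M t ht
  let q : EuclideanSpace ℝ ι → ℝ := fun x => WithLp.ofLp x ⬝ᵥ Matrix.mulVec M (WithLp.ofLp x)
  have hqc : Continuous q := by
    simp only [q, dotProduct, Matrix.mulVec]
    fun_prop
  have hqsmul : ∀ (c : ℝ) x, q (c • x) = c ^ 2 * q x := by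
    intro c x
    simp only [q, WithLp.ofLp_smul, Matrix.mulVec_smul, dotProduct_smul, smul_dotProduct,
      smul_eq_mul]
    ring
  have hqs : ∀ x ∈ s, |q x| ≤ t := fun x hx => ht _ (Finset.mem_image_of_mem _ hx)
  suffices h : ∀ x, |q x| ≤ 32 * t * ‖x‖ ^ 2 by
    intro v
    rw [← norm_toLp_sq_eq_dotProduct]
    exact h (WithLp.toLp 2 v)
  by_cases hne : (Metric.sphere (0 : EuclideanSpace ℝ ι) 1).Nonempty
  · obtain ⟨x, hx, hmax⟩ := (isCompact_sphere (0 : EuclideanSpace ℝ ι) 1).exists_isMaxOn hne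
      hqc.abs.continuousOn
    have hx1 : ‖x‖ = 1 := by simpa using hx
    have hle : ∀ u, |q u| ≤ |q x| * ‖u‖ ^ 2 := by
      intro u
      rcases eq_or_ne u 0 with rfl | hu
      · simp [q]
      · have hu' : ‖u‖ ≠ 0 := norm_ne_zero_iff.2 hu
        have h1 : |q (‖u‖⁻¹ • u)| ≤ |q x| := by
          refine hmax ?_
          simp [norm_smul, hu']
        rw [hqsmul, abs_mul, abs_of_nonneg (sq_nonneg _)] at h1
        calc |q u| = (‖u‖⁻¹ ^ 2 * |q u|) * ‖u‖ ^ 2 := by field_simp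
          _ ≤ _ := by gcongr
    obtain ⟨y, hy, hxy⟩ := hs2 x hx1
    have hy1 := hs1 y hy
    have hpol : 4 * (q x - q y) =
        q ((5 / 2 : ℝ) • x - (3 / 2 : ℝ) • y) - q ((3 / 2 : ℝ) • x - (5 / 2 : ℝ) • y) := by
      simp only [q, WithLp.ofLp_sub, WithLp.ofLp_smul, Matrix.mulVec_sub, Matrix.mulVec_smul,
        dotProduct_sub, sub_dotProduct, dotProduct_smul, smul_dotProduct, smul_eq_mul]
      ring
    have hinner : 7 / 8 ≤ inner ℝ x y := by
      have := norm_sub_sq_real x y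
      rw [hx1, hy1] at this
      nlinarith [norm_nonneg (x - y)]
    have hn1 : ‖(5 / 2 : ℝ) • x - (3 / 2 : ℝ) • y‖ ^ 2 ≤ 31 / 16 := by
      rw [norm_sub_sq_real, norm_smul, norm_smul, inner_smul_left, inner_smul_right, hx1, hy1]
      norm_num
      linarith
    have hn2 : ‖(3 / 2 : ℝ) • x - (5 / 2 : ℝ) • y‖ ^ 2 ≤ 31 / 16 := by
      rw [norm_sub_sq_real, norm_smul, norm_smul, inner_smul_left, inner_smul_right, hx1, hy1]
      norm_num
      linarith
    have h1 := (hle _).trans (mul_le_mul_of_nonneg_left hn1 (abs_nonneg (q x)))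
    have h2 := (hle _).trans (mul_le_mul_of_nonneg_left hn2 (abs_nonneg (q x)))
    have h3 : |q x| ≤ |q y| + |q x - q y| := by
      have := abs_add_le (q y) (q x - q y)
      rwa [add_sub_cancel] at this
    have h4 : 4 * |q x - q y| ≤ |q x| * (31 / 16) + |q x| * (31 / 16) := by
      have : 4 * |q x - q y| = |4 * (q x - q y)| := by rw [abs_mul]; norm_num
      rw [this, hpol]
      exact (abs_sub _ _).trans (add_le_add h1 h2)
    have h5 : |q x| ≤ 32 * t := by linarith [hqs y hy]
    exact fun u => (hle u).trans (mul_le_mul_of_nonneg_right h5 (sq_nonneg _))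
  · intro u
    have hu : u = 0 := by
      by_contra hu
      exact hne ⟨‖u‖⁻¹ • u, by simp [norm_smul, hu]⟩
    simp [hu, q]

theorem exp_le_quadratic_remainder (y : ℝ) :
    Real.exp y ≤ 1 + y + y ^ 2 * Real.exp |y| := by
  have h := Complex.norm_exp_sub_sum_le_norm_mul_exp (y : ℂ) 2
  have h1 : Complex.exp y - ∑ m ∈ Finset.range 2, (y : ℂ) ^ m / (m.factorial : ℂ) =
      ((Real.exp y - (1 + y) : ℝ) : ℂ) := by
    simp [Finset.sum_range_succ]
  rw [h1, Complex.norm_real, Complex.norm_real, Real.norm_eq_abs, Real.norm_eq_abs, sq_abs] at h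
  linarith [(abs_le.1 h).2]

theorem integrable_exp_mul_sum_of_iIndepFun {Ω ι : Type*} [Fintype ι] [MeasurableSpace Ω]
    {μ : Measure Ω} [IsFiniteMeasure μ] {X : ι → Ω → ℝ} {t : ℝ} (hind : iIndepFun X μ)
    (hmeas : ∀ i, AEMeasurable (X i) μ)
    (hint : ∀ i, Integrable (fun ω => Real.exp (t * X i ω)) μ) :
    Integrable (fun ω => Real.exp (t * (∑ i, X i) ω)) μ := by
  have hae := fun i => (hmeas i).ae_eq_mk
  have h := (hind.congr hae).integrable_exp_mul_sum (t := t) (s := Finset.univ)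
    (fun i => (hmeas i).measurable_mk) fun i _ => (hint i).congr <| by
      filter_upwards [hae i] with ω hω
      rw [hω]
  refine h.congr ?_
  filter_upwards [ae_all_iff.2 hae] with ω hω
  simp only [Finset.sum_apply, hω]

section Bernstein

variable {𝓧 : Type*} [MeasurableSpace 𝓧] {p : Measure 𝓧}
  {Z : 𝓧 → ℝ} {K : ℝ}

theorem integrable_exp_div_of_lintegral_le (hZ : Measurable Z)
    (h : ∫⁻ x, ENNReal.ofReal (Real.exp (Z x / K)) ∂p ≤ 2) :
    Integrable (fun x => Real.exp (Z x / K)) p := by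
  refine ⟨by fun_prop, ?_⟩
  rw [hasFiniteIntegral_iff_ofReal (ae_of_all _ fun x => (Real.exp_pos _).le)]
  exact h.trans_lt (by simp)

theorem integral_exp_div_le (hZ : Measurable Z)
    (h : ∫⁻ x, ENNReal.ofReal (Real.exp (Z x / K)) ∂p ≤ 2) :
    ∫ x, Real.exp (Z x / K) ∂p ≤ 2 := by
  rw [integral_eq_lintegral_of_nonneg_ae (ae_of_all _ fun x => (Real.exp_pos _).le) (by fun_prop)]
  exact ENNReal.toReal_le_of_le_ofReal (by norm_num) (by simpa using h)

theorem integrable_of_lintegral_exp_le (hK : 0 < K) (hZ : Measurable Z) (hZ0 : ∀ x, 0 ≤ Z x)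
    (h : ∫⁻ x, ENNReal.ofReal (Real.exp (Z x / K)) ∂p ≤ 2) : Integrable Z p := by
  refine Integrable.mono' ((integrable_exp_div_of_lintegral_le hZ h).const_mul K) (by fun_prop)
    (ae_of_all _ fun x => ?_)
  rw [Real.norm_of_nonneg (hZ0 x)]
  have := Real.add_one_le_exp (Z x / K)
  calc Z x = K * (Z x / K) := by field_simp
    _ ≤ _ := by gcongr; linarith

theorem integrable_exp_mul_of_lintegral_exp_le (hK : 0 < K) (hZ : Measurable Z)
    (hZ0 : ∀ x, 0 ≤ Z x) (h : ∫⁻ x, ENNReal.ofReal (Real.exp (Z x / K)) ∂p ≤ 2) {s : ℝ}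
    (hs : |s| ≤ 1 / (2 * K)) : Integrable (fun x => Real.exp (s * Z x)) p := by
  refine Integrable.mono' (integrable_exp_div_of_lintegral_le hZ h) (by fun_prop)
    (ae_of_all _ fun x => ?_)
  rw [Real.norm_of_nonneg (Real.exp_pos _).le, Real.exp_le_exp]
  have h1 : s * Z x ≤ 1 / (2 * K) * Z x :=
    mul_le_mul_of_nonneg_right ((le_abs_self s).trans hs) (hZ0 x)
  have h2 : 1 / (2 * K) * Z x = Z x / K / 2 := by field_simp
  have h3 : 0 ≤ Z x / K := div_nonneg (hZ0 x) hK.le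
  linarith

theorem integral_exp_mul_le [IsProbabilityMeasure p] (hK : 0 < K) (hZ : Measurable Z)
    (hZ0 : ∀ x, 0 ≤ Z x) (h : ∫⁻ x, ENNReal.ofReal (Real.exp (Z x / K)) ∂p ≤ 2) {s : ℝ}
    (hs : |s| ≤ 1 / (2 * K)) :
    ∫ x, Real.exp (s * Z x) ∂p ≤ Real.exp (s * ∫ x, Z x ∂p + 16 * s ^ 2 * K ^ 2) := by
  have hpt : ∀ x, Real.exp (s * Z x) ≤
      1 + s * Z x + 8 * s ^ 2 * K ^ 2 * Real.exp (Z x / K) := by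
    intro x
    refine (exp_le_quadratic_remainder _).trans ?_
    have hW : 0 ≤ Z x / K := div_nonneg (hZ0 x) hK.le
    have h1 : |s * Z x| ≤ Z x / K / 2 := by
      rw [abs_mul, abs_of_nonneg (hZ0 x)]
      calc _ ≤ 1 / (2 * K) * Z x := mul_le_mul_of_nonneg_right hs (hZ0 x)
        _ = _ := by field_simp
    have h2 : (Z x / K) ^ 2 ≤ 8 * Real.exp (Z x / K / 2) := by
      have := Real.quadratic_le_exp_of_nonneg (x := Z x / K / 2) (by positivity)
      nlinarith
    have h3 : (s * Z x) ^ 2 * Real.exp |s * Z x| ≤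
        8 * s ^ 2 * K ^ 2 * Real.exp (Z x / K) := by
      calc (s * Z x) ^ 2 * Real.exp |s * Z x|
          = s ^ 2 * K ^ 2 * ((Z x / K) ^ 2 * Real.exp |s * Z x|) := by field_simp
        _ ≤ s ^ 2 * K ^ 2 * (8 * Real.exp (Z x / K / 2) * Real.exp (Z x / K / 2)) := by
            gcongr
        _ = _ := by
            rw [mul_assoc 8, ← Real.exp_add, add_halves]; ring
    linarith
  have hi1 := integrable_of_lintegral_exp_le hK hZ hZ0 h
  have hi2 := integrable_exp_div_of_lintegral_le hZ h
  calc ∫ x, Real.exp (s * Z x) ∂p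
      ≤ ∫ x, (1 + s * Z x + 8 * s ^ 2 * K ^ 2 * Real.exp (Z x / K)) ∂p :=
        integral_mono (integrable_exp_mul_of_lintegral_exp_le hK hZ hZ0 h hs)
          (((integrable_const _).add (hi1.const_mul _)).add (hi2.const_mul _)) hpt
    _ = 1 + s * ∫ x, Z x ∂p + 8 * s ^ 2 * K ^ 2 * ∫ x, Real.exp (Z x / K) ∂p := by
        have hi3 : Integrable (fun x => 1 + s * Z x) p :=
          (integrable_const _).add (hi1.const_mul _)
        rw [integral_add hi3 (hi2.const_mul _), integral_add (integrable_const _) (hi1.const_mul _), integral_const_mul,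
          integral_const_mul]
        simp
    _ ≤ 1 + s * ∫ x, Z x ∂p + 8 * s ^ 2 * K ^ 2 * 2 := by
        gcongr
        exact integral_exp_div_le hZ h
    _ ≤ _ := by
        refine le_trans (le_of_eq ?_) (Real.add_one_le_exp _)
        ring

/-- Bernstein's inequality for the mean of nonnegative sub-exponential variables. -/
theorem measureReal_abs_mean_sub_ge_le {Ω : Type*} [MeasurableSpace Ω] {μ : Measure Ω}
    [IsProbabilityMeasure μ] [IsProbabilityMeasure p] {n : ℕ} {X : Fin n → Ω → 𝓧} (hX : ∀ r, HasLaw (X r) p μ)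
    (hind : iIndepFun X μ) (hK : 0 < K) (hZ : Measurable Z) (hZ0 : ∀ x, 0 ≤ Z x)
    (h : ∫⁻ x, ENNReal.ofReal (Real.exp (Z x / K)) ∂p ≤ 2) {s t : ℝ} (hs0 : 0 ≤ s)
    (hs : s ≤ 1 / (2 * K)) (hst : 32 * s * K ^ 2 ≤ t) :
    μ.real {ω | t ≤ |(n : ℝ)⁻¹ * ∑ r, Z (X r ω) - ∫ x, Z x ∂p|} ≤
      2 * Real.exp (-(n * (s * t / 2))) := by
  have hindZ : iIndepFun (fun r => Z ∘ X r) μ := hind.comp (fun _ => Z) fun _ => hZ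
  have hmeasZ : ∀ r, AEMeasurable (Z ∘ X r) μ := fun r =>
    hZ.comp_aemeasurable (hX r).aemeasurable
  have hmgf : ∀ s' : ℝ, |s'| ≤ 1 / (2 * K) → mgf (∑ r, Z ∘ X r) μ s' ≤
      Real.exp (n * (s' * ∫ x, Z x ∂p + 16 * s' ^ 2 * K ^ 2)) := by
    intro s' hs'
    rw [hindZ.mgf_sum₀ hmeasZ, Real.exp_nat_mul]
    refine (Finset.prod_le_prod (fun r _ => mgf_nonneg) fun r _ => ?_).trans_eq
      (by rw [Finset.prod_const, Finset.card_univ, Fintype.card_fin])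
    have h1 : mgf (Z ∘ X r) μ s' = ∫ x, Real.exp (s' * Z x) ∂p :=
      (hX r).integral_comp (f := fun x => Real.exp (s' * Z x)) (by fun_prop)
    rw [h1]
    exact integral_exp_mul_le hK hZ hZ0 h hs'
  have hint : ∀ s' : ℝ, |s'| ≤ 1 / (2 * K) →
      Integrable (fun ω => Real.exp (s' * (∑ r, Z ∘ X r) ω)) μ := by
    intro s' hs'
    refine integrable_exp_mul_sum_of_iIndepFun hindZ hmeasZ fun r => ?_
    have h2 := integrable_exp_mul_of_lintegral_exp_le hK hZ hZ0 h hs'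
    rw [← (hX r).map_eq] at h2
    exact h2.comp_aemeasurable (hX r).aemeasurable
  have hexp : n * (s * t / 2) ≤ n * (s * t - 16 * s ^ 2 * K ^ 2) := by
    refine mul_le_mul_of_nonneg_left ?_ (Nat.cast_nonneg n)
    nlinarith
  set e := ∫ x, Z x ∂p with he
  have hsabs : |s| ≤ 1 / (2 * K) := by rwa [abs_of_nonneg hs0]
  have hup : μ.real {ω | n * (e + t) ≤ (∑ r, Z ∘ X r) ω} ≤ Real.exp (-(n * (s * t / 2))) := by
    refine (measure_ge_le_exp_mul_mgf _ hs0 (hint s hsabs)).trans ?_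
    refine (mul_le_mul_of_nonneg_left (hmgf s hsabs) (Real.exp_pos _).le).trans ?_
    rw [← Real.exp_add, Real.exp_le_exp]
    linarith
  have hdown : μ.real {ω | (∑ r, Z ∘ X r) ω ≤ n * (e - t)} ≤
      Real.exp (-(n * (s * t / 2))) := by
    have hsabs' : |-s| ≤ 1 / (2 * K) := by rwa [abs_neg]
    refine (measure_le_le_exp_mul_mgf _ (neg_nonpos.2 hs0) (hint (-s) hsabs')).trans ?_
    refine (mul_le_mul_of_nonneg_left (hmgf (-s) hsabs') (Real.exp_pos _).le).trans ?_
    rw [← Real.exp_add, Real.exp_le_exp]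
    linarith
  have hsub : {ω | t ≤ |(n : ℝ)⁻¹ * ∑ r, Z (X r ω) - e|} ⊆
      {ω | n * (e + t) ≤ (∑ r, Z ∘ X r) ω} ∪ {ω | (∑ r, Z ∘ X r) ω ≤ n * (e - t)} := by
    intro ω hω
    have hω' : t ≤ |(n : ℝ)⁻¹ * ∑ r, Z (X r ω) - e| := hω
    have hmul : (n : ℝ) * ((n : ℝ)⁻¹ * ∑ r, Z (X r ω)) = ∑ r, Z (X r ω) := by
      rcases Nat.eq_zero_or_pos n with rfl | hn
      · simp
      · field_simp
    have hn : (0 : ℝ) ≤ n := Nat.cast_nonneg n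
    rcases le_abs.1 hω' with h1 | h1
    · left
      simp only [Set.mem_ofPred_eq, Finset.sum_apply, Function.comp_apply]
      rw [← hmul]
      exact mul_le_mul_of_nonneg_left (by linarith) hn
    · right
      simp only [Set.mem_ofPred_eq, Finset.sum_apply, Function.comp_apply]
      rw [← hmul]
      exact mul_le_mul_of_nonneg_left (by linarith) hn
  refine (measureReal_mono hsub).trans ((measureReal_union_le _ _).trans ?_)
  linarith

end Bernstein

namespace PairwiseFamily
variable {d : ℕ} (F : PairwiseFamily d)

theorem measurable_nodeVec (i : Fin d) (a : F.NodeIndex i) :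
    Measurable fun x => F.nodeVec i x a :=
  (((F.contDiff_stat _ a.2).continuous_fderiv (by norm_num)).clm_apply
    continuous_const).measurable

theorem measurable_dotProduct_nodeVec_sq (i : Fin d) (v : F.NodeIndex i → ℝ) :
    Measurable fun x => (v ⬝ᵥ F.nodeVec i x) ^ 2 :=
  (Finset.measurable_fun_sum _ fun a _ => (F.measurable_nodeVec i a).const_mul (v a)).pow_const 2

theorem integrable_nodeVec_mul {p : Measure (Fin d → ℝ)} {L : ℝ} (hL : 0 < L)
    (h : ∀ i, IsSubGaussianVector (F.nodeVec i) L p) (i : Fin d) (a b : F.NodeIndex i) :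
    Integrable (fun x => F.nodeVec i x a * F.nodeVec i x b) p := by
  have hsq : ∀ a, Integrable (fun x => F.nodeVec i x a ^ 2) p := by
    intro a
    have h1 := integrable_of_lintegral_exp_le (sq_pos_of_pos hL)
      (F.measurable_dotProduct_nodeVec_sq i (Pi.single a 1)) (fun x => sq_nonneg _)
      (h i (Pi.single a 1) (by simp))
    simpa using h1
  refine Integrable.mono' ((hsq a).add (hsq b))
    ((F.measurable_nodeVec i a).mul (F.measurable_nodeVec i b)).aestronglyMeasurable
    (ae_of_all _ fun x => ?_)
  simp only [Real.norm_eq_abs, Pi.add_apply]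
  rw [abs_le]
  constructor <;> nlinarith [sq_nonneg (F.nodeVec i x a + F.nodeVec i x b),
    sq_nonneg (F.nodeVec i x a - F.nodeVec i x b)]

theorem dotProduct_sq_eq_sum {ι : Type*} [Fintype ι] (v w : ι → ℝ) :
    (v ⬝ᵥ w) ^ 2 = ∑ a, ∑ b, v a * (w a * w b * v b) := by
  rw [sq, dotProduct, Finset.sum_mul_sum]
  exact Finset.sum_congr rfl fun a _ => Finset.sum_congr rfl fun b _ => by ring

theorem quadForm_popNodeGamma {p : Measure (Fin d → ℝ)}
    (hint : ∀ i a b, Integrable (fun x => F.nodeVec i x a * F.nodeVec i x b) p) (i : Fin d)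
    (v : F.NodeIndex i → ℝ) :
    v ⬝ᵥ Matrix.mulVec (F.popNodeGamma p i) v = ∫ x, (v ⬝ᵥ F.nodeVec i x) ^ 2 ∂p := by
  have hint' : ∀ a b, Integrable
      (fun x => v a * (F.nodeVec i x a * F.nodeVec i x b * v b)) p :=
    fun a b => ((hint i a b).mul_const _).const_mul _
  simp only [dotProduct_sq_eq_sum]
  rw [integral_finsetSum _ fun a _ => integrable_finsetSum _ fun b _ => hint' a b]
  simp only [dotProduct, Matrix.mulVec, Finset.mul_sum]
  refine Finset.sum_congr rfl fun a _ => ?_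
  rw [integral_finsetSum _ fun b _ => hint' a b]
  refine Finset.sum_congr rfl fun b _ => ?_
  rw [integral_const_mul, integral_mul_const]
  rfl

theorem quadForm_empNodeGamma {n : ℕ} (X : Fin n → Fin d → ℝ) (i : Fin d)
    (v : F.NodeIndex i → ℝ) :
    v ⬝ᵥ Matrix.mulVec (F.empNodeGamma X i) v =
      (n : ℝ)⁻¹ * ∑ r, (v ⬝ᵥ F.nodeVec i (X r)) ^ 2 := by
  simp only [dotProduct_sq_eq_sum]
  rw [Finset.sum_comm, Finset.mul_sum]
  simp only [dotProduct, Matrix.mulVec, Finset.mul_sum]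
  refine Finset.sum_congr rfl fun a _ => ?_
  rw [Finset.sum_comm]
  refine Finset.sum_congr rfl fun b _ => ?_
  simp only [empNodeGamma, Matrix.of_apply, Finset.mul_sum, Finset.sum_mul]
  exact Finset.sum_congr rfl fun r _ => by ring

theorem card_nodeIndex_le (i : Fin d) : Fintype.card (F.NodeIndex i) ≤ F.maxStat * d := by
  rw [Fintype.card_sigma]
  refine (Finset.sum_le_card_nsmul _ _ F.maxStat fun j _ => ?_).trans_eq
    (by simp [mul_comm])
  simpa using F.numStat_le s(j, i)

theorem card_paramIndex_le :
    Fintype.card F.ParamIndex ≤ (F.maxStat * d) ^ 2 := by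
  have h := sum_sym2_le (d := d) (fun e => (F.maxStat : ℝ)) fun e => Nat.cast_nonneg _
  have h1 : Fintype.card F.ParamIndex ≤ F.maxStat * d ^ 2 := by
    rw [Fintype.card_sigma]
    have h2 : ∑ e, Fintype.card (Fin (F.numStat e)) ≤ ∑ _e : Sym2 (Fin d), F.maxStat :=
      Finset.sum_le_sum fun e _ => by simpa using F.numStat_le e
    refine h2.trans ?_
    have h3 : ((∑ _e : Sym2 (Fin d), F.maxStat : ℕ) : ℝ) ≤ ((F.maxStat * d ^ 2 : ℕ) : ℝ) := by
      push_cast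
      refine h.trans_eq ?_
      simp
      ring
    exact_mod_cast h3
  refine h1.trans ?_
  rw [mul_pow]
  gcongr
  exact Nat.le_self_pow (by norm_num) _

section Probability

variable {Ω : Type*} [MeasurableSpace Ω] {μ : Measure Ω}
  {p : Measure (Fin d → ℝ)} {n : ℕ} {X : Fin n → Ω → Fin d → ℝ}

theorem measureReal_exists_le {ι : Type*} [Fintype ι] (P : ι → Ω → Prop) {C : ℝ}
    (h : ∀ i, μ.real {ω | P i ω} ≤ C) :
    μ.real {ω | ∃ i, P i ω} ≤ Fintype.card ι * C := by
  have : {ω | ∃ i, P i ω} = ⋃ i, {ω | P i ω} := by ext; simp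
  rw [this]
  refine (measureReal_iUnion_fintype_le _).trans ?_
  refine (Finset.sum_le_card_nsmul _ _ C fun i _ => h i).trans_eq ?_
  simp

/-- The smallest eigenvalues of the matrices `Γ̂_i` are bounded below with high probability. -/
theorem measureReal_exists_quadForm_lt_le [IsProbabilityMeasure μ] [IsProbabilityMeasure p]
    {lo L s : ℝ} (hL : 0 < L) (hX : ∀ r, HasLaw (X r) p μ) (hind : iIndepFun X μ)
    (hsub : ∀ i, IsSubGaussianVector (F.nodeVec i) L p)
    (hquad : ∀ i v, lo * ∑ a, v a ^ 2 ≤ v ⬝ᵥ Matrix.mulVec (F.popNodeGamma p i) v)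
    (hs0 : 0 ≤ s) (hs : s ≤ 1 / (2 * L ^ 2)) (hsl : 32 * s * (L ^ 2) ^ 2 ≤ lo / 64) :
    μ.real {ω | ∃ i v, v ⬝ᵥ Matrix.mulVec (F.empNodeGamma (fun r => X r ω) i) v <
        lo / 2 * ∑ a, v a ^ 2} ≤
      d * (5 ^ (F.maxStat * d) * (2 * Real.exp (-(n * (s * (lo / 64) / 2))))) := by
  have hint := F.integrable_nodeVec_mul hL hsub
  refine (measureReal_exists_le (C := 5 ^ (F.maxStat * d) *
    (2 * Real.exp (-(n * (s * (lo / 64) / 2))))) _ fun i => ?_).trans_eq (by simp)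
  obtain ⟨S, hcard, hS1, hS2⟩ := exists_finset_quadForm_le (F.NodeIndex i)
  have hbern : ∀ v : S, μ.real {ω | lo / 64 ≤
      |(n : ℝ)⁻¹ * ∑ r, (v.1 ⬝ᵥ F.nodeVec i (X r ω)) ^ 2 -
        ∫ x, (v.1 ⬝ᵥ F.nodeVec i x) ^ 2 ∂p|} ≤ 2 * Real.exp (-(n * (s * (lo / 64) / 2))) :=
    fun v => measureReal_abs_mean_sub_ge_le hX hind (sq_pos_of_pos hL)
      (F.measurable_dotProduct_nodeVec_sq i v.1) (fun x => sq_nonneg _)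
      (hsub i v.1 (hS1 v.1 v.2)) hs0 hs hsl
  refine (measureReal_mono ?_).trans ((measureReal_exists_le _ hbern).trans ?_)
  · rintro ω ⟨v, hv⟩
    by_contra hcon
    simp only [Set.mem_ofPred_eq, not_exists, not_le] at hcon
    have h1 := hS2 (F.empNodeGamma (fun r => X r ω) i - F.popNodeGamma p i) (lo / 64) (by
      intro w hw
      rw [Matrix.sub_mulVec, dotProduct_sub, F.quadForm_empNodeGamma,
        F.quadForm_popNodeGamma hint]
      exact (hcon ⟨w, hw⟩).le) v
    rw [Matrix.sub_mulVec, dotProduct_sub] at h1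
    have h2 := (abs_le.1 h1).1
    have h3 := hquad i v
    have h4 : v ⬝ᵥ v = ∑ a, v a ^ 2 := by simp [dotProduct, sq]
    rw [h4] at h2
    linarith
  · refine mul_le_mul_of_nonneg_right ?_ (by positivity)
    rw [Fintype.card_coe]
    have h5 : S.card ≤ 5 ^ (F.maxStat * d) :=
      hcard.trans (Nat.pow_le_pow_right (by norm_num) (F.card_nodeIndex_le i))
    exact_mod_cast h5

variable {F} in
theorem TailBounds.measureReal_exists_le {c₁ c₂ ν c t : ℝ}
    (h : F.TailBounds μ p X c₁ c₂ ν) (hc₁ : c ≤ c₁) (hc₂ : c ≤ c₂) (ht : 0 < t) (htν : t ≤ ν)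
    (hN : 1 ≤ F.maxStat * d) :
    μ.real {ω | (∃ k, t ≤ |F.empK (fun r => X r ω) k - F.popK p k|) ∨
      ∃ i a b, t ≤ |F.empNodeGamma (fun r => X r ω) i a b - F.popNodeGamma p i a b|} ≤
      2 * ((F.maxStat * d : ℝ) ^ 3 * Real.exp (-(c * n * t ^ 2))) := by
  have hm : 1 ≤ F.maxStat := Nat.pos_of_mul_pos_right hN
  have hexp : ∀ c', c ≤ c' → Real.exp (-(c' * n * t ^ 2)) ≤ Real.exp (-(c * n * t ^ 2)) := by
    intro c' hc'
    gcongr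
  set ex := Real.exp (-(c * n * t ^ 2))
  have hex : 0 ≤ ex := (Real.exp_pos _).le
  have hNr : (1 : ℝ) ≤ F.maxStat * d := by exact_mod_cast hN
  have h1 : μ.real {ω | ∃ k, t ≤ |F.empK (fun r => X r ω) k - F.popK p k|} ≤
      (F.maxStat * d : ℝ) ^ 3 * ex := by
    refine (PairwiseFamily.measureReal_exists_le _ fun k =>
      (h.1 k t ht htν).trans (hexp _ hc₁)).trans ?_
    refine mul_le_mul_of_nonneg_right ?_ hex
    have h2 : (Fintype.card F.ParamIndex : ℝ) ≤ (F.maxStat * d : ℝ) ^ 2 := by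
      exact_mod_cast F.card_paramIndex_le
    exact h2.trans (pow_le_pow_right₀ hNr (by norm_num))
  have h2 : μ.real {ω | ∃ i a b,
      t ≤ |F.empNodeGamma (fun r => X r ω) i a b - F.popNodeGamma p i a b|} ≤
      (F.maxStat * d : ℝ) ^ 3 * ex := by
    have hcard : ∀ i, (Fintype.card (F.NodeIndex i) : ℝ) ≤ F.maxStat * d := fun i => by
      exact_mod_cast F.card_nodeIndex_le i
    have h3 : ∀ i, μ.real {ω | ∃ a b,
        t ≤ |F.empNodeGamma (fun r => X r ω) i a b - F.popNodeGamma p i a b|} ≤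
        (F.maxStat * d : ℝ) * ((F.maxStat * d : ℝ) * ex) := by
      intro i
      refine (PairwiseFamily.measureReal_exists_le
        (C := (F.maxStat * d : ℝ) * ex) _ fun a => ?_).trans
        (mul_le_mul_of_nonneg_right (hcard i) (by positivity))
      exact (PairwiseFamily.measureReal_exists_le _ fun b =>
        (h.2 i a b t ht htν).trans (hexp _ hc₂)).trans
        (mul_le_mul_of_nonneg_right (hcard i) hex)
    refine (PairwiseFamily.measureReal_exists_le _ h3).trans ?_
    rw [Fintype.card_fin]
    have hd : (d : ℝ) ≤ F.maxStat * d := by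
      exact_mod_cast Nat.le_mul_of_pos_left d hm
    calc _ ≤ (F.maxStat * d : ℝ) * ((F.maxStat * d : ℝ) * ((F.maxStat * d : ℝ) * ex)) := by
          gcongr
      _ = _ := by ring
  have hun : {ω | (∃ k, t ≤ |F.empK (fun r => X r ω) k - F.popK p k|) ∨
      ∃ i a b, t ≤ |F.empNodeGamma (fun r => X r ω) i a b - F.popNodeGamma p i a b|} =
      {ω | ∃ k, t ≤ |F.empK (fun r => X r ω) k - F.popK p k|} ∪ {ω | ∃ i a b,
        t ≤ |F.empNodeGamma (fun r => X r ω) i a b - F.popNodeGamma p i a b|} := rfl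
  rw [hun]
  refine (measureReal_union_le _ _).trans ?_
  linarith

/-- The size of the deviations of `K̂` and `Γ̂_i` that are exceeded with probability at most
`2 (md)^{-a}`. -/
def deviation (c : ℝ) (a n : ℕ) : ℝ := √((3 + a) * Real.log (F.maxStat * d) / (c * n))

variable {F} in
theorem TailBounds.measureReal_deviation_le {c₁ c₂ ν c : ℝ} {a : ℕ}
    (h : F.TailBounds μ p X c₁ c₂ ν) (hc : 0 < c) (hc₁ : c ≤ c₁) (hc₂ : c ≤ c₂) (hn : 0 < n)
    (htν : F.deviation c a n ≤ ν) (hN : 2 ≤ F.maxStat * d) :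
    μ.real {ω | (∃ k, F.deviation c a n ≤ |F.empK (fun r => X r ω) k - F.popK p k|) ∨
      ∃ i k l, F.deviation c a n ≤
        |F.empNodeGamma (fun r => X r ω) i k l - F.popNodeGamma p i k l|} ≤
      2 / (F.maxStat * d : ℝ) ^ a := by
  have hNr : (2 : ℝ) ≤ F.maxStat * d := by exact_mod_cast hN
  have hlog : 0 < Real.log (F.maxStat * d) := Real.log_pos (by linarith)
  have hnr : (0 : ℝ) < n := by exact_mod_cast hn
  have hpos : 0 < (3 + a) * Real.log (F.maxStat * d) / (c * n) := by positivity
  refine (h.measureReal_exists_le (t := F.deviation c a n) hc₁ hc₂ (Real.sqrt_pos.2 hpos) htν (by omega)).trans_eq ?_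
  have h1 : c * n * F.deviation c a n ^ 2 =
      ((3 + a : ℕ) : ℝ) * Real.log (F.maxStat * d) := by
    rw [deviation, Real.sq_sqrt hpos.le]
    push_cast
    field_simp
  rw [h1, Real.exp_neg, Real.exp_nat_mul, Real.exp_log (by linarith), pow_add]
  have h0 : (F.maxStat * d : ℝ) ≠ 0 := by positivity
  generalize (F.maxStat * d : ℝ) = N at h0 ⊢
  field_simp

end Probability
/-- `√(m κ² log(md) / n)`. -/
def baseRate (p : Measure (Fin d → ℝ)) (n : ℕ) : ℝ :=
  √(F.maxStat * F.kappa p ^ 2 * Real.log (F.maxStat * d) / n)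

/-- The ratio between the bound for the group norms of the noise and `√(m κ² log(md) / n)`. -/
def noiseConst (c κ₀ : ℝ) (a : ℕ) : ℝ := (2 + 1 / κ₀) * √((3 + a) / c)

theorem sqrt_maxStat_mul_le {p : Measure (Fin d → ℝ)} {c κ₀ : ℝ} (hκ₀ : 0 < κ₀)
    (hκ : κ₀ ≤ F.kappa p) (a n : ℕ) :
    √F.maxStat * (2 * (F.deviation c a n * F.kappa p) + F.deviation c a n) ≤
      noiseConst c κ₀ a * F.baseRate p n := by
  have hκ' : 0 < F.kappa p := hκ₀.trans_le hκ
  have hlog : 0 ≤ Real.log (F.maxStat * d) := by exact_mod_cast Real.log_natCast_nonneg _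
  have h1 : F.deviation c a n = √((3 + a) / c) * √(Real.log (F.maxStat * d) / n) := by
    rw [deviation, mul_div_mul_comm, Real.sqrt_mul' _ (by positivity)]
  have h2 : F.baseRate p n = √F.maxStat * F.kappa p * √(Real.log (F.maxStat * d) / n) := by
    rw [baseRate, mul_div_assoc, Real.sqrt_mul (by positivity), Real.sqrt_mul (by positivity),
      Real.sqrt_sq hκ'.le]
  have h3 : F.deviation c a n ≤ 1 / κ₀ * (F.deviation c a n * F.kappa p) := by
    rw [one_div, ← div_eq_inv_mul, le_div_iff₀ hκ₀]
    exact mul_le_mul_of_nonneg_left hκ (Real.sqrt_nonneg _)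
  calc _ ≤ √F.maxStat * (2 * (F.deviation c a n * F.kappa p) +
        1 / κ₀ * (F.deviation c a n * F.kappa p)) := by gcongr
    _ = _ := by rw [noiseConst, h2, h1]; ring

theorem measureReal_exists_solution_le {Ω : Type*} [MeasurableSpace Ω] {μ : Measure Ω}
    [IsProbabilityMeasure μ] {p : Measure (Fin d → ℝ)} [IsProbabilityMeasure p] {n : ℕ}
    {X : Fin n → Ω → Fin d → ℝ} {G : SimpleGraph (Fin d)} {a : ℕ}
    {lo hi c₁ c₂ ν c L κ₀ s lam M : ℝ} (hlo : 0 < lo) (hL : 0 < L) (hκ₀ : 0 < κ₀)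
    (hX : ∀ r, HasLaw (X r) p μ) (hind : iIndepFun X μ)
    (hev : F.EigenvalueBounds p lo hi) (hG : F.IsSparse G (F.popParam p))
    (htail : F.TailBounds μ p X c₁ c₂ ν)
    (hsub : ∀ i, IsSubGaussianVector (F.nodeVec i) L p)
    (hN : 2 ≤ F.maxStat * d) (hκ : κ₀ ≤ F.kappa p)
    (hc : 0 < c) (hc₁ : c ≤ c₁) (hc₂ : c ≤ c₂) (hn : 0 < n) (hdev : F.deviation c a n ≤ ν)
    (hs0 : 0 ≤ s) (hs : s ≤ 1 / (2 * L ^ 2)) (hsl : 32 * s * (L ^ 2) ^ 2 ≤ lo / 64)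
    (hlam : 0 ≤ lam)
    (hM : (noiseConst c κ₀ a * F.baseRate p n ≤ lam ∧ 16 * lam / lo ≤ M * F.baseRate p n) ∨
      4 * (noiseConst c κ₀ a * F.baseRate p n + lam) * d / lo ≤ M * F.baseRate p n) :
    μ.real {ω | ∃ θ, F.IsScoreMatchingSolution (fun r => X r ω) lam θ ∧
      M * (√(d + G.edgeSet.ncard) * F.baseRate p n) <
        ‖WithLp.toLp 2 (θ - F.popParam p)‖} ≤
      2 / (F.maxStat * d : ℝ) ^ a +
        d * (5 ^ (F.maxStat * d) * (2 * Real.exp (-(n * (s * (lo / 64) / 2))))) := by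
  have hquad := F.popNodeGamma_quadForm_ge hev
  have hint := F.integrable_nodeVec_mul hL hsub
  refine (measureReal_mono ?_).trans ((measureReal_union_le _ _).trans
    (add_le_add (htail.measureReal_deviation_le (a := a) hc hc₁ hc₂ hn hdev hN)
      (F.measureReal_exists_quadForm_lt_le hL hX hind hsub hquad hs0 hs hsl)))
  rintro ω ⟨θ, hθ, hbig⟩
  by_contra hcon
  simp only [Set.mem_union, Set.mem_ofPred_eq, not_or, not_exists, not_le, not_lt] at hcon
  obtain ⟨⟨hK, hΓ⟩, hemp⟩ := hcon
  have ht : 0 ≤ F.deviation c a n := Real.sqrt_nonneg _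
  have hg := F.abs_score_gradient_le hlo ht hint hquad (fun r => X r ω)
    (fun k => (hK k).le) (fun i k l => (hΓ i k l).le)
  have hb : 0 ≤ 2 * (F.deviation c a n * F.kappa p) + F.deviation c a n := by
    have := hκ₀.trans_le hκ
    positivity
  have hnoise := F.sqrt_maxStat_mul_le (c := c) hκ₀ hκ a n
  refine hbig.not_ge ?_
  rcases hM with ⟨h1, h2⟩ | h2
  · refine (hθ.norm_sub_le_of_dominated hlo hemp hb hg hG (hnoise.trans h1)).trans ?_
    calc _ ≤ M * F.baseRate p n * √(d + G.edgeSet.ncard) := by gcongr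
      _ = _ := by ring
  · have h3 : (1 : ℝ) ≤ √(d + G.edgeSet.ncard) := by
      refine Real.one_le_sqrt.2 ?_
      have hd : 1 ≤ d := Nat.pos_of_mul_pos_left (by omega : 0 < F.maxStat * d)
      have : (1 : ℝ) ≤ d := by exact_mod_cast hd
      have : (0 : ℝ) ≤ G.edgeSet.ncard := Nat.cast_nonneg _
      linarith
    have h0 : 0 ≤ F.baseRate p n := Real.sqrt_nonneg _
    have h4 : 0 ≤ M * F.baseRate p n := le_trans
      (div_nonneg (mul_nonneg (mul_nonneg (by norm_num) (add_nonneg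
        (hnoise.trans' (by positivity)) hlam)) (Nat.cast_nonneg d)) hlo.le) h2
    refine (hθ.norm_sub_le hlo hemp hb hg hlam).trans ?_
    calc _ ≤ 4 * (noiseConst c κ₀ a * F.baseRate p n + lam) * d / lo := by gcongr
      _ ≤ M * F.baseRate p n := h2
      _ ≤ M * F.baseRate p n * √(d + G.edgeSet.ncard) := le_mul_of_one_le_right h4 h3
      _ = _ := by ring

end PairwiseFamily

theorem mul_five_pow_mul_exp_le {d N n : ℕ} {β : ℝ} (hd : d ≤ N) (h : 6 * N ≤ n * β) :
    d * (5 ^ N * (2 * Real.exp (-(n * β)))) ≤ 2 * Real.exp (-(n * (β / 2))) := by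
  have h1 : (d : ℝ) ≤ Real.exp N := by
    have h2 : (d : ℝ) ≤ N := by exact_mod_cast hd
    linarith [Real.add_one_le_exp (N : ℝ)]
  have h2 : (5 : ℝ) ^ N ≤ Real.exp (2 * N) := by
    rw [mul_comm, Real.exp_nat_mul]
    refine pow_le_pow_left₀ (by norm_num) ?_ _
    have := Real.quadratic_le_exp_of_nonneg (x := 2) (by norm_num)
    linarith
  calc _ ≤ Real.exp N * (Real.exp (2 * N) * (2 * Real.exp (-(n * β)))) := by gcongr
    _ = 2 * Real.exp (N + 2 * N + -(n * β)) := by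
        rw [Real.exp_add, Real.exp_add]; ring
    _ ≤ _ := by
        gcongr
        linarith

theorem log_div_le_sq_of_le {x c n y : ℝ} {k : ℝ} (hx : 0 < x) (hc : 0 < c) (hn : 0 < n)
    (hk : 0 ≤ k) (h : k * x ≤ c * y ^ 2 * n) (hy : 0 ≤ y) :
    √(k * Real.log x / (c * n)) ≤ y := by
  refine Real.sqrt_le_iff.2 ⟨hy, ?_⟩
  rw [div_le_iff₀ (by positivity)]
  have := Real.log_le_sub_one_of_pos hx
  nlinarith [mul_le_mul_of_nonneg_left (show Real.log x ≤ x by linarith) hk]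

end

end ScoreMatching

theorem theorem1 (lo hi c₁ c₂ ν L κ₀ : ℝ) (hlo : 0 < lo) (hc₁ : 0 < c₁) (hc₂ : 0 < c₂)
    (hν : 0 < ν) (hL : 0 < L) (hκ₀ : 0 < κ₀) :
    -- constants that depend only on the constants in the assumptions
    ∃ Clam : ℝ, 0 < Clam ∧ ∃ Csize : ℝ, 0 < Csize ∧
    ∀ (Ω : ℕ → Type*) [∀ n, MeasurableSpace (Ω n)]
      (μ : ∀ n, Measure (Ω n)) [∀ n, IsProbabilityMeasure (μ n)]
      (d : ℕ → ℕ) (F : ∀ n, ScoreMatching.PairwiseFamily (d n))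
      (G : ∀ n, SimpleGraph (Fin (d n)))
      (p : ∀ n, Measure (Fin (d n) → ℝ))
      (X : ∀ n, Fin n → Ω n → Fin (d n) → ℝ)
      (lam : ℕ → ℝ) (Cup : ℝ),
      -- i.i.d. data with distribution `p n`
      (∀ n, IsProbabilityMeasure (p n)) →
      (∀ n r, HasLaw (X n r) (p n) (μ n)) →
      (∀ n, iIndepFun (X n) (μ n)) →
      (∀ n k, Integrable (fun x => (F n).scoreVec x k) (p n)) →
      -- the assumptions
      (∀ n, (F n).EigenvalueBounds (p n) lo hi) →
      (∀ n, (F n).IsSparse (G n) ((F n).popParam (p n))) →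
      (∀ n, (F n).TailBounds (μ n) (p n) (X n) c₁ c₂ ν) →
      (∀ n i, ScoreMatching.IsSubGaussianVector ((F n).nodeVec i) L (p n)) →
      (∀ n, 2 ≤ (F n).maxStat * d n) →
      (∀ n, κ₀ ≤ (F n).kappa (p n)) →
      -- the regularization parameter and the sample size
      (∀ᶠ n : ℕ in atTop,
        Clam * √((F n).maxStat * (F n).kappa (p n) ^ 2 * Real.log ((F n).maxStat * d n) / n)
            ≤ lam n ∧
        lam n ≤
          Cup * √((F n).maxStat * (F n).kappa (p n) ^ 2 * Real.log ((F n).maxStat * d n) / n)) →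
      (∀ᶠ n : ℕ in atTop, Csize * ((F n).maxStat * d n) ≤ n) →
      -- every solution is within `O_p(rate)` of the population parameter
      ∀ ε : ℝ, 0 < ε → ∃ M : ℝ, ∀ᶠ n : ℕ in atTop,
        (μ n).real {ω | ∃ θ : (F n).ParamIndex → ℝ,
          (F n).IsScoreMatchingSolution (fun r => X n r ω) (lam n) θ ∧
          M * √((d n + (G n).edgeSet.ncard) * (F n).maxStat * (F n).kappa (p n) ^ 2
                * Real.log ((F n).maxStat * d n) / n)
            < ‖WithLp.toLp 2 (θ - (F n).popParam (p n))‖} ≤ ε := by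
  set s : ℝ := min (1 / (2 * L ^ 2)) (lo / 64 / (32 * (L ^ 2) ^ 2)) with hs_def
  have hs0 : 0 < s := lt_min (by positivity) (by positivity)
  have hs : s ≤ 1 / (2 * L ^ 2) := min_le_left _ _
  have hsl : 32 * s * (L ^ 2) ^ 2 ≤ lo / 64 := by
    have h : s ≤ lo / 64 / (32 * (L ^ 2) ^ 2) := min_le_right _ _
    rw [le_div_iff₀ (by positivity)] at h
    linarith
  set β : ℝ := s * (lo / 64) / 2 with hβ_def
  have hβ : 0 < β := by positivity
  set c : ℝ := min c₁ c₂
  have hc : 0 < c := lt_min hc₁ hc₂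
  have hnc : ∀ a, 0 < ScoreMatching.PairwiseFamily.noiseConst c κ₀ a := fun a => by
    unfold ScoreMatching.PairwiseFamily.noiseConst; positivity
  refine ⟨ScoreMatching.PairwiseFamily.noiseConst c κ₀ 1, hnc 1,
    max (6 / β) (4 / (c * ν ^ 2)), lt_max_of_lt_left (by positivity), ?_⟩
  intro Ω _ μ _ d F G p X lam Cup hp hX hind _ hev hG htail hsub hN hκ hlam hsize ε hε
  obtain ⟨D, hD⟩ := exists_nat_ge (4 / ε)
  obtain ⟨a, ha⟩ := pow_unbounded_of_one_lt (4 / ε) (one_lt_two (α := ℝ))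
  set B : ℝ := ScoreMatching.PairwiseFamily.noiseConst c κ₀ a
  have hB : 0 < B := hnc a
  refine ⟨16 * |Cup| / lo + 4 * (B + |Cup|) * D / lo, ?_⟩
  have hexp : ∀ᶠ n : ℕ in atTop, 2 * Real.exp (-(n * (β / 2))) ≤ ε / 2 := by
    have h1 : Tendsto (fun n : ℕ => 2 * Real.exp (-(n * (β / 2)))) atTop (nhds (2 * 0)) :=
      (Real.tendsto_exp_neg_atTop_nhds_zero.comp
        (tendsto_natCast_atTop_atTop.atTop_mul_const (by positivity))).const_mul 2
    rw [mul_zero] at h1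
    exact h1.eventually_le_const (by positivity)
  have hlarge : ∀ᶠ n : ℕ in atTop, (3 + a) * (D : ℝ) ≤ c * ν ^ 2 * n :=
    (tendsto_natCast_atTop_atTop.const_mul_atTop (by positivity)).eventually_ge_atTop _
  filter_upwards [hlam, hsize, hexp, hlarge, eventually_gt_atTop 0] with n hlam hsize hexp hlarge hn
  have := hp n
  have hnr : (0 : ℝ) < n := by exact_mod_cast hn
  have hNr : (2 : ℝ) ≤ (F n).maxStat * d n := by exact_mod_cast hN n
  have hdN : d n ≤ (F n).maxStat * d n :=
    Nat.le_mul_of_pos_left _ (Nat.pos_of_mul_pos_right (two_pos.trans_le (hN n)))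
  set ρ : ℝ := (F n).baseRate (p n) n with hρ_def
  have hρ : 0 ≤ ρ := Real.sqrt_nonneg _
  have hlo' : ScoreMatching.PairwiseFamily.noiseConst c κ₀ 1 * ρ ≤ lam n := hlam.1
  have hup' : lam n ≤ |Cup| * ρ :=
    le_trans hlam.2 (mul_le_mul_of_nonneg_right (le_abs_self Cup) hρ)
  have hlam0 : 0 ≤ lam n := le_trans (mul_nonneg (hnc 1).le hρ) hlo'
  have hrate : √((d n + (G n).edgeSet.ncard) * (F n).maxStat * (F n).kappa (p n) ^ 2
      * Real.log ((F n).maxStat * d n) / n) = √(d n + (G n).edgeSet.ncard) * ρ := by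
    rw [hρ_def, ScoreMatching.PairwiseFamily.baseRate, ← Real.sqrt_mul (by positivity)]
    congr 1
    ring
  rw [hrate]
  have h6 : 6 * (((F n).maxStat * d n : ℕ) : ℝ) ≤ n * β := by
    have h := (mul_le_mul_of_nonneg_right (le_max_left (6 / β) (4 / (c * ν ^ 2)))
      (by positivity : (0 : ℝ) ≤ (F n).maxStat * d n)).trans hsize
    rw [div_mul_eq_mul_div, div_le_iff₀ hβ] at h
    push_cast
    exact h
  have hnet := (ScoreMatching.mul_five_pow_mul_exp_le hdN h6).trans hexp
  by_cases hcase : (F n).maxStat * d n ≤ D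
  · have hcase' : ((F n).maxStat * d n : ℝ) ≤ D := by exact_mod_cast hcase
    have hdD : (d n : ℝ) ≤ D := by exact_mod_cast hdN.trans hcase
    have hdev : (F n).deviation c a n ≤ ν := by
      refine ScoreMatching.log_div_le_sq_of_le (by linarith) hc hnr (by positivity) ?_ hν.le
      exact (mul_le_mul_of_nonneg_left hcase' (by positivity)).trans hlarge
    refine ((F n).measureReal_exists_solution_le (a := a) hlo hL hκ₀ (hX n) (hind n) (hev n) (hG n)
      (htail n) (hsub n) (hN n) (hκ n) hc (min_le_left _ _) (min_le_right _ _) hn hdev hs0.le hs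
      hsl hlam0 (Or.inr ?_)).trans ?_
    · calc 4 * (B * ρ + lam n) * d n / lo ≤ 4 * (B * ρ + |Cup| * ρ) * D / lo := by gcongr
        _ = 4 * (B + |Cup|) * D / lo * ρ := by ring
        _ ≤ _ := by
          refine mul_le_mul_of_nonneg_right (le_add_of_nonneg_left ?_) hρ
          positivity
    · have h1 : 2 / ((F n).maxStat * d n : ℝ) ^ a ≤ ε / 2 := by
        rw [div_le_iff₀ (by positivity)]
        have h2 := pow_le_pow_left₀ (by norm_num) hNr a
        have h3 := ha.le.trans h2
        rw [div_le_iff₀ hε] at h3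
        linarith
      linarith
  · have hcase' : (D : ℝ) ≤ (F n).maxStat * d n := by exact_mod_cast (not_le.1 hcase).le
    have hdev : (F n).deviation c 1 n ≤ ν := by
      refine ScoreMatching.log_div_le_sq_of_le (by linarith) hc hnr (by positivity) ?_ hν.le
      have h := (mul_le_mul_of_nonneg_right (le_max_right (6 / β) (4 / (c * ν ^ 2)))
        (by positivity : (0 : ℝ) ≤ (F n).maxStat * d n)).trans hsize
      rw [div_mul_eq_mul_div, div_le_iff₀ (by positivity)] at h
      push_cast
      linarith
    refine ((F n).measureReal_exists_solution_le (a := 1) hlo hL hκ₀ (hX n) (hind n) (hev n) (hG n)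
      (htail n) (hsub n) (hN n) (hκ n) hc (min_le_left _ _) (min_le_right _ _) hn hdev hs0.le hs
      hsl hlam0 (Or.inl ⟨hlo', ?_⟩)).trans ?_
    · calc 16 * lam n / lo ≤ 16 * (|Cup| * ρ) / lo := by gcongr
        _ = 16 * |Cup| / lo * ρ := by ring
        _ ≤ _ := by
          refine mul_le_mul_of_nonneg_right (le_add_of_nonneg_right ?_) hρ
          positivity
    · have h1 : 2 / ((F n).maxStat * d n : ℝ) ^ 1 ≤ ε / 2 := by
        rw [pow_one, div_le_iff₀ (by linarith)]
        have h3 := hD.trans hcase'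
        rw [div_le_iff₀ hε] at h3
        linarith
      linarith
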